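/- Let $\beta,\gamma>0$ be fixed. For $n\ge 1$ let $m=\lfloor\beta n\rfloor$ and $p=\gamma/n$ (with $n$ large enough that $p\le 1$). Let $\mathcal B^{(n)}$ be the random bipartite graph with parts $\mathcal V=\{v_1,\dots,v_n\}$ and $\mathcal A=\{a_1,\dots,a_m\}$ in which each of the $nm$ possible edges is present independently with probability $p$. The random intersection graph $\mathcal G^{(n)}$ is the graph on $\mathcal V$ in which two distinct vertices are adjacent if and only if they have a common neighbour in $\mathcal A$ in $\mathcal B^{(n)}$. The size of a connected component is its number of vertices, and an event holds asymptotically almost surely (a.a.s.) if its probability tends to $1$ as $n\to\infty$. Set $\mu=\beta\gamma^2$, let $$g(s)=\exp\bigl\{\beta\gamma\bigl(e^{\gamma(s-1)}-1\bigr)\bigr\}$$ be the generating function of the compound Poisson distribution $\mathrm{CPoisson}(\beta\gamma,\gamma)$, and let $\rho$ be the smallest non-negative solution of $\rho=g(\rho)$. (i) If $\mu<1$, then there is a constant $C=C(\beta,\gamma)>0$ such that a.a.s. every connected component of $\mathcal G^{(n)}$ has at most $C\log n$ vertices. (ii) If $\mu>1$, then $0<\rho<1$, the size $L_1$ of the largest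 connected component of $\mathcal G^{(n)}$ satisfies $L_1/n\to 1-\rho$ in probability as $n\to\infty$, and there is a constant $C=C(\beta,\gamma)>0$ such that a.a.s. exactly one connected component of $\mathcal G^{(n)}$ has more than $C\log n$ vertices (the unique giant component) and the second largest connected component has at most $C\log n$ vertices. -/

import Mathlib

open MeasureTheory ProbabilityTheory Filter Topology

namespace RandomIntersectionGraph

/-- A bipartite graph between the vertices `v₁, …, vₙ` and the auxiliary vertices `a₁, …, aₘ`:
`B (i, k) = true` means that `vᵢ` and `aₖ` are adjacent. -/
abbrev Bipartite (n m : ℕ) : Type := Fin n × Fin m → Bool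

/-- The law of the random bipartite graph: every one of the `n * m` edges is present with
probability `p`, independently of the others. -/
noncomputable def bipartiteLaw (n m : ℕ) (p : unitInterval) : Measure (Bipartite n m) :=
  Measure.pi fun _ => bernoulliMeasure true false p

/-- The intersection graph of `B`: distinct vertices are adjacent iff they have a common
auxiliary neighbour. -/
def intersectionGraph {n m : ℕ} (B : Bipartite n m) : SimpleGraph (Fin n) where
  Adj i j := i ≠ j ∧ ∃ k : Fin m, B (i, k) = true ∧ B (j, k) = true
  symm := ⟨fun _ _ h => ⟨h.1.symm, h.2.imp fun _ hk => ⟨hk.2, hk.1⟩⟩⟩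
  loopless := ⟨fun _ h => h.1 rfl⟩

/-- The number of auxiliary vertices, `m = ⌊β n⌋`. -/
noncomputable def auxCount (β : ℝ) (n : ℕ) : ℕ := ⌊β * n⌋₊

/-- The edge probability `p = γ / n`, truncated to `[0, 1]`; for `γ > 0` the truncation only acts
at the finitely many `n` with `γ / n > 1`. -/
noncomputable def edgeProb (γ : ℝ) (n : ℕ) : unitInterval :=
  Set.projIcc (0 : ℝ) 1 zero_le_one (γ / n)

/-- The probability that the random intersection graph on `n` vertices, with `⌊β n⌋` auxiliary
vertices and edge probability `γ / n`, has the property `Q`. -/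
noncomputable def prob (β γ : ℝ) (n : ℕ) (Q : SimpleGraph (Fin n) → Prop) : ENNReal :=
  bipartiteLaw n (auxCount β n) (edgeProb γ n) {B | Q (intersectionGraph B)}

/-- A graph property holds asymptotically almost surely. -/
def AAS (β γ : ℝ) (Q : (n : ℕ) → SimpleGraph (Fin n) → Prop) : Prop :=
  Tendsto (fun n : ℕ => prob β γ n (Q n)) atTop (𝓝 1)

/-- A real-valued graph functional converges to the constant `a` in probability. -/
def TendstoInProb (β γ : ℝ) (X : (n : ℕ) → SimpleGraph (Fin n) → ℝ) (a : ℝ) : Prop :=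
  ∀ ε : ℝ, 0 < ε →
    Tendsto (fun n : ℕ => prob β γ n fun G => ε ≤ |X n G - a|) atTop (𝓝 0)

/-- The number of vertices of a connected component. -/
noncomputable def componentSize {V : Type*} {G : SimpleGraph V} (c : G.ConnectedComponent) : ℕ :=
  c.supp.ncard

/-- For `k ≥ 1`, the size of the `k`-th largest component, counted with multiplicity: the largest
`s` such that at least `k` components have `s` or more vertices
(and `0` if there are fewer than `k` components). -/
noncomputable def kthLargestSize {V : Type*} (G : SimpleGraph V) (k : ℕ) : ℕ :=
  sSup {s : ℕ | k ≤ {c : G.ConnectedComponent | s ≤ componentSize c}.ncard}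

/-- The generating function of the compound Poisson distribution `CPoisson(a, b)`. -/
noncomputable def cpoissonGF (a b s : ℝ) : ℝ :=
  Real.exp (a * (Real.exp (b * (s - 1)) - 1))

end RandomIntersectionGraph

/-! A component is explored in the bipartite graph by retiring active vertices one at a time, each
exposing only its edges to unseen vertices. Instead of a coupling with a branching process, the
proof uses potentials: put weights ζ on the vertices and η on the auxiliary vertices. If (ζ, η) is a
supersolution of the two-type branching recursion, induction along the exploration gives `E[s ^
|cluster U|] ≤ ζ ^ |U|`; a subsolution gives the reverse (`reachWeight_le`,
`le_integral_prod_reach`). Eliminating η leaves a comparison of ζ with g(ζ), where g is `cpoissonGF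
(β * γ) γ` and g'(1) = μ.

If μ < 1, some ζ > 1 has g(ζ) < ζ. This allows s > 1, so component sizes have exponential tails and
a union bound finishes.

If μ > 1, then g(ζ) < ζ exactly for ζ in (ρ, 1) among ζ in [0, 1). Such a ζ still allows s > 1 as
long as most vertices are unexplored, so sizes between C log n and δn are unlikely (`cluster_gap`).
Letting ζ tend to ρ from both sides, a vertex is in a small component with probability about ρ and a
pair with probability at most about ρ², so Chebyshev puts about ρn vertices in small components. For
uniqueness a small proportion of the auxiliary vertices is held back. Large clusters formed without
them are joined by them (`sprinkling`), and since the number of small vertices hardly changes, no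
large component can be made of formerly small ones (`exists_unique_large_component`). -/

namespace RandomIntersectionGraph

/-! ### Independence of the edges. -/

section Independence

variable {n m : ℕ} {p : unitInterval}

instance (n m : ℕ) (p : unitInterval) : IsProbabilityMeasure (bipartiteLaw n m p) := by
  unfold bipartiteLaw; infer_instance

lemma integrable_bipartiteLaw (f : Bipartite n m → ℝ) : Integrable f (bipartiteLaw n m p) :=
  Integrable.of_finite

lemma integral_mul_of_dependsOn {f g : Bipartite n m → ℝ} {S T : Set (Fin n × Fin m)}
    (hST : Disjoint S T) (hf : DependsOn f S) (hg : DependsOn g T) :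
    ∫ B, f B * g B ∂bipartiteLaw n m p =
      (∫ B, f B ∂bipartiteLaw n m p) * ∫ B, g B ∂bipartiteLaw n m p := by
  classical
  have hind : iIndepFun (fun (e : Fin n × Fin m) (B : Bipartite n m) => B e)
      (bipartiteLaw n m p) :=
    iIndepFun_pi (X := fun _ => id) fun _ => aemeasurable_id
  have hfin := hind.indepFun_finset S.toFinset T.toFinset
    (by simpa using hST) fun e => measurable_pi_apply e
  obtain ⟨f', rfl⟩ := dependsOn_iff_exists_comp.1 (hf.mono (t := (S.toFinset : Set _)) (by simp))
  obtain ⟨g', rfl⟩ := dependsOn_iff_exists_comp.1 (hg.mono (t := (T.toFinset : Set _)) (by simp))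
  have := (hfin.comp (φ := f') (ψ := g') (Measurable.of_discrete) (Measurable.of_discrete))
  exact this.integral_mul_eq_mul_integral (integrable_bipartiteLaw _).aestronglyMeasurable
    (integrable_bipartiteLaw _).aestronglyMeasurable

lemma integral_bernoulli (f : Bool → ℝ) :
    ∫ b, f b ∂(bernoulliMeasure true false p) = p * f true + (1 - p) * f false := by
  have h := integral_bernoulliMeasure (p := p) (x := true) (y := false) f
  simpa using h

lemma integral_prod_edges (f : Fin n × Fin m → Bool → ℝ) :
    ∫ B, ∏ e, f e (B e) ∂bipartiteLaw n m p = ∏ e, (p * f e true + (1 - p) * f e false) := by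
  unfold bipartiteLaw
  rw [integral_fintype_prod_eq_prod]
  simp only [integral_bernoulli]

lemma integral_prod_edges_finset (E : Finset (Fin n × Fin m)) (f : Fin n × Fin m → Bool → ℝ) :
    ∫ B, ∏ e ∈ E, f e (B e) ∂bipartiteLaw n m p =
      ∏ e ∈ E, (p * f e true + (1 - p) * f e false) := by
  classical
  have h := integral_prod_edges (p := p) fun e b => if e ∈ E then f e b else 1
  simp only [Finset.prod_ite_mem, Finset.univ_inter] at h
  have h' := Finset.prod_ite_mem Finset.univ E fun e => p * f e true + (1 - p) * f e false
  rw [Finset.univ_inter] at h'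
  rw [h, ← h']
  refine Finset.prod_congr rfl fun e _ => ?_
  split_ifs
  · rfl
  · ring

end Independence

/-! ### Exploration of the bipartite graph. -/

section Exploration

variable {n m : ℕ}

/-- Adjacency in the bipartite graph `B`, as a relation on the disjoint union of the parts. -/
def bipAdj (B : Bipartite n m) : Fin n ⊕ Fin m → Fin n ⊕ Fin m → Prop
  | .inl v, .inr a => B (v, a) = true
  | .inr a, .inl v => B (v, a) = true
  | _, _ => False

noncomputable instance (B : Bipartite n m) : DecidableRel (bipAdj B) := Classical.decRel _

/-- The neighbours of `x` inside `R`. -/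
noncomputable def nbrs (B : Bipartite n m) (x : Fin n ⊕ Fin m) (R : Finset (Fin n ⊕ Fin m)) :
    Finset (Fin n ⊕ Fin m) := R.filter (bipAdj B x)

open Classical in
/-- The vertices that can be reached from `U` by paths that stay in `R` after their first vertex. -/
noncomputable def reach (B : Bipartite n m) (U R : Finset (Fin n ⊕ Fin m)) :
    Finset (Fin n ⊕ Fin m) :=
  Finset.univ.filter fun x =>
    ∃ u ∈ U, Relation.ReflTransGen (fun y z => bipAdj B y z ∧ z ∈ R) u x

variable {B B' : Bipartite n m} {U R S : Finset (Fin n ⊕ Fin m)} {x y : Fin n ⊕ Fin m}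

lemma mem_nbrs : y ∈ nbrs B x R ↔ y ∈ R ∧ bipAdj B x y := by simp [nbrs]

lemma nbrs_subset : nbrs B x R ⊆ R := Finset.filter_subset _ _

lemma mem_reach : x ∈ reach B U R ↔
    ∃ u ∈ U, Relation.ReflTransGen (fun y z => bipAdj B y z ∧ z ∈ R) u x := by simp [reach]

lemma subset_reach : U ⊆ reach B U R := fun x hx => mem_reach.2 ⟨x, hx, .refl⟩

lemma mem_reach_of_adj (hx : x ∈ reach B U R) (h : bipAdj B x y) (hy : y ∈ R) :
    y ∈ reach B U R := by
  obtain ⟨u, hu, h'⟩ := mem_reach.1 hx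
  exact mem_reach.2 ⟨u, hu, h'.tail ⟨h, hy⟩⟩

/-- `reach B U R` is the smallest set containing `U` and closed under steps into `R`. -/
lemma reach_subset (hU : U ⊆ S) (h : ∀ x ∈ S, ∀ y ∈ R, bipAdj B x y → y ∈ S) :
    reach B U R ⊆ S := by
  intro x hx
  obtain ⟨u, hu, hux⟩ := mem_reach.1 hx
  induction hux with
  | refl => exact hU hu
  | tail h1 h2 ih => exact h _ (ih (mem_reach.2 ⟨u, hu, h1⟩)) _ h2.2 h2.1

lemma reach_mono {U' R' : Finset (Fin n ⊕ Fin m)} (hU : U ⊆ U') (hR : R ⊆ R') :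
    reach B U R ⊆ reach B U' R' :=
  reach_subset (hU.trans subset_reach) fun _ hx _ hy h => mem_reach_of_adj hx h (hR hy)

lemma reach_subset_union : reach B U R ⊆ U ∪ R :=
  reach_subset Finset.subset_union_left fun _ _ _ hy _ => Finset.mem_union_right _ hy

@[simp] lemma reach_empty : reach B ∅ R = ∅ :=
  Finset.subset_empty.1 (reach_subset (by simp) (by simp))

lemma reach_sdiff_self : reach B U (R \ U) = reach B U R := by
  refine (reach_mono subset_rfl Finset.sdiff_subset).antisymm
    (reach_subset subset_reach fun x hx y hy h => ?_)
  by_cases hyU : y ∈ U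
  · exact subset_reach hyU
  · exact mem_reach_of_adj hx h (Finset.mem_sdiff.2 ⟨hy, hyU⟩)

/-- One exploration step: `x` is retired and its neighbours become active. Deleting them from `R`
loses nothing, since they are now starting points. -/
lemma reach_eq_insert (hx : x ∈ U) :
    reach B U R = insert x (reach B (U.erase x ∪ nbrs B x R) (R \ nbrs B x R)) := by
  apply Finset.Subset.antisymm
  · refine reach_subset (fun y hy => ?_) fun y hy z hz h => ?_
    · by_cases hyx : y = x
      · simp [hyx]
      · exact Finset.mem_insert_of_mem (subset_reach (by simp [hyx, hy]))
    · by_cases hzN : z ∈ nbrs B x R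
      · exact Finset.mem_insert_of_mem (subset_reach (by simp [hzN]))
      · rcases Finset.mem_insert.1 hy with rfl | hy
        · exact absurd (mem_nbrs.2 ⟨hz, h⟩) hzN
        · exact Finset.mem_insert_of_mem (mem_reach_of_adj hy h (by simp [hz, hzN]))
  · refine Finset.insert_subset (subset_reach hx) (reach_subset ?_ ?_)
    · refine Finset.union_subset ((Finset.erase_subset _ _).trans subset_reach) fun y hy => ?_
      exact mem_reach_of_adj (subset_reach hx) (mem_nbrs.1 hy).2 (mem_nbrs.1 hy).1
    · exact fun y hy z hz h => mem_reach_of_adj hy h (Finset.mem_sdiff.1 hz).1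

lemma notMem_reach_step (hd : Disjoint U R) (hx : x ∈ U) :
    x ∉ reach B (U.erase x ∪ nbrs B x R) (R \ nbrs B x R) := by
  intro h
  have hxR : x ∉ R := Finset.disjoint_left.1 hd hx
  have := reach_subset_union h
  simp only [Finset.mem_union, Finset.mem_erase, Finset.mem_sdiff] at this
  rcases this with (h | h) | h
  · exact h.1 rfl
  · exact hxR (nbrs_subset h)
  · exact hxR h.1

lemma sdiff_reach_step (hd : Disjoint U R) (hx : x ∈ U) :
    R \ reach B U R =
      (R \ nbrs B x R) \ reach B (U.erase x ∪ nbrs B x R) (R \ nbrs B x R) := by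
  have hxR : x ∉ R := Finset.disjoint_left.1 hd hx
  rw [reach_eq_insert hx]
  ext y
  simp only [Finset.mem_sdiff, Finset.mem_insert, not_or]
  constructor
  · rintro ⟨hy, -, h⟩
    exact ⟨⟨hy, fun hN => h (subset_reach (by simp [hN]))⟩, h⟩
  · rintro ⟨⟨hy, -⟩, h⟩
    exact ⟨hy, fun e => hxR (e ▸ hy), h⟩

lemma bipAdj_congr (h : ∀ e : Fin n × Fin m, Sum.inl e.1 ∈ S → Sum.inr e.2 ∈ S → B e = B' e)
    (hx : x ∈ S) (hy : y ∈ S) : bipAdj B x y ↔ bipAdj B' x y := by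
  rcases x with v | a <;> rcases y with w | b <;> simp only [bipAdj]
  · rw [h (v, b) hx hy]
  · rw [h (w, a) hy hx]

/-- Once `x` is retired it lies outside the remaining sets, so the rest of the exploration never
looks at an edge at `x`. With `dependsOn_nbrs` this makes each step independent of what follows. -/
lemma dependsOn_reach : DependsOn (fun B : Bipartite n m => reach B U R)
    {e | Sum.inl e.1 ∈ U ∪ R ∧ Sum.inr e.2 ∈ U ∪ R} := by
  have key : ∀ B B' : Bipartite n m,
      (∀ e : Fin n × Fin m, Sum.inl e.1 ∈ U ∪ R → Sum.inr e.2 ∈ U ∪ R → B e = B' e) →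
      reach B U R ⊆ reach B' U R := by
    intro B B' h
    refine (reach_subset (S := reach B' U R) subset_reach fun x hx y hy hxy => ?_)
    exact mem_reach_of_adj hx ((bipAdj_congr h (reach_subset_union hx)
      (Finset.mem_union_right _ hy)).1 hxy) hy
  intro B B' h
  exact (key B B' fun e h1 h2 => h e ⟨h1, h2⟩).antisymm
    (key B' B fun e h1 h2 => (h e ⟨h1, h2⟩).symm)

lemma dependsOn_nbrs : DependsOn (fun B : Bipartite n m => nbrs B x R)
    {e | Sum.inl e.1 = x ∨ Sum.inr e.2 = x} := by
  intro B B' h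
  ext y
  simp only [mem_nbrs]
  refine and_congr_right fun _ => ?_
  rcases x with v | a <;> rcases y with w | b <;> simp only [bipAdj]
  · rw [h (v, b) (by simp)]
  · rw [h (w, a) (by simp)]

end Exploration

/-! ### Potentials for the exploration. -/

section Potential

variable {n m : ℕ} {p : unitInterval}

open Classical in
/-- The expectation of the product of the weights `z` over the set reached from `U`, restricted to
the event that the unreached part of `R` satisfies `P`. -/
noncomputable def reachWeight (p : unitInterval) (z : Fin n ⊕ Fin m → ℝ)
    (P : Finset (Fin n ⊕ Fin m) → Prop) (U R : Finset (Fin n ⊕ Fin m)) : ℝ :=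
  ∫ B, (if P (R \ reach B U R) then ∏ x ∈ reach B U R, z x else 0) ∂bipartiteLaw n m p

lemma integral_fiberwise {α : Type*} [DecidableEq α] (T : Finset α) (X : Bipartite n m → α)
    (hX : ∀ B, X B ∈ T) (F : α → Bipartite n m → ℝ) :
    ∫ B, F (X B) B ∂bipartiteLaw n m p =
      ∑ N ∈ T, ∫ B, (if X B = N then 1 else 0) * F N B ∂bipartiteLaw n m p := by
  rw [← integral_finsetSum _ fun _ _ => integrable_bipartiteLaw _]
  congr 1 with B
  simp [hX B]

open Classical in
-- The Markov property: given that the exposed neighbourhood of `x` is `N`, a fresh exploration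
-- starts from the updated active set.
lemma reachWeight_eq_sum {z : Fin n ⊕ Fin m → ℝ} {P : Finset (Fin n ⊕ Fin m) → Prop}
    {U R : Finset (Fin n ⊕ Fin m)} {x : Fin n ⊕ Fin m} (hd : Disjoint U R) (hx : x ∈ U) :
    reachWeight p z P U R = ∑ N ∈ R.powerset,
      (∫ B, (if nbrs B x R = N then 1 else 0) ∂bipartiteLaw n m p) *
        (z x * reachWeight p z P (U.erase x ∪ N) (R \ N)) := by
  have h1 : reachWeight p z P U R = ∫ B, (fun N B => z x *
      (if P ((R \ N) \ reach B (U.erase x ∪ N) (R \ N)) then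
        ∏ y ∈ reach B (U.erase x ∪ N) (R \ N), z y else 0)) (nbrs B x R) B
        ∂bipartiteLaw n m p := by
    unfold reachWeight
    congr 1 with B
    rw [sdiff_reach_step hd hx]
    dsimp only
    split_ifs
    · conv_lhs => rw [reach_eq_insert hx]
      rw [Finset.prod_insert (notMem_reach_step hd hx)]
    · simp
  rw [h1]
  refine (integral_fiberwise R.powerset (fun B => nbrs B x R)
    (fun B => Finset.mem_powerset.2 nbrs_subset) fun N B => z x *
      (if P ((R \ N) \ reach B (U.erase x ∪ N) (R \ N)) then
        ∏ y ∈ reach B (U.erase x ∪ N) (R \ N), z y else 0)).trans ?_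
  refine Finset.sum_congr rfl fun N hN => ?_
  have hxR : x ∉ R := Finset.disjoint_left.1 hd hx
  have hxN : x ∉ U.erase x ∪ N ∪ R \ N := by
    simp only [Finset.mem_union, Finset.mem_erase, Finset.mem_sdiff, not_or, not_and]
    exact ⟨⟨fun h => absurd rfl h, fun h => hxR (Finset.mem_powerset.1 hN h)⟩,
      fun h => absurd h hxR⟩
  rw [integral_mul_of_dependsOn (S := {e | Sum.inl e.1 = x ∨ Sum.inr e.2 = x})
    (T := {e | Sum.inl e.1 ∈ U.erase x ∪ N ∪ R \ N ∧ Sum.inr e.2 ∈ U.erase x ∪ N ∪ R \ N})]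
  · rw [integral_const_mul, reachWeight]
  · rw [Set.disjoint_left]
    rintro e (h | h) ⟨h1, h2⟩
    · exact hxN (h ▸ h1)
    · exact hxN (h ▸ h2)
  · intro B B' h
    simp only [dependsOn_nbrs h]
  · intro B B' h
    simp only [dependsOn_reach h]

open Classical in
lemma sum_nbrs_prob_mul {R : Finset (Fin n ⊕ Fin m)} {x : Fin n ⊕ Fin m}
    (f : Finset (Fin n ⊕ Fin m) → ℝ) :
    ∑ N ∈ R.powerset, (∫ B, (if nbrs B x R = N then 1 else 0) ∂bipartiteLaw n m p) * f N =
      ∫ B, f (nbrs B x R) ∂bipartiteLaw n m p := by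
  rw [integral_fiberwise R.powerset (fun B => nbrs B x R)
    (fun B => Finset.mem_powerset.2 nbrs_subset) fun N _ => f N]
  simp only [integral_mul_const]

lemma prod_erase_union {z : Fin n ⊕ Fin m → ℝ} {U R N : Finset (Fin n ⊕ Fin m)}
    (hd : Disjoint U R) (hN : N ⊆ R) (x : Fin n ⊕ Fin m) :
    ∏ y ∈ U.erase x ∪ N, z y = (∏ y ∈ U.erase x, z y) * ∏ y ∈ N, z y :=
  Finset.prod_union ((hd.mono_right hN).mono_left (Finset.erase_subset _ _))

lemma disjoint_step {U R N : Finset (Fin n ⊕ Fin m)} (hd : Disjoint U R) (x : Fin n ⊕ Fin m) :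
    Disjoint (U.erase x ∪ N) (R \ N) := by
  rw [Finset.disjoint_union_left]
  exact ⟨(hd.mono_right Finset.sdiff_subset).mono_left (Finset.erase_subset _ _),
    Finset.disjoint_sdiff⟩

lemma card_step_lt {U R N : Finset (Fin n ⊕ Fin m)} {x : Fin n ⊕ Fin m}
    (hd : Disjoint U R) (hx : x ∈ U) (hN : N ⊆ R) :
    ((U.erase x ∪ N) ∪ R \ N).card < (U ∪ R).card := by
  refine Finset.card_lt_card ⟨fun y hy => ?_, fun h => ?_⟩
  · simp only [Finset.mem_union, Finset.mem_erase, Finset.mem_sdiff] at hy ⊢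
    rcases hy with (h | h) | h
    exacts [.inl h.2, .inr (hN h), .inr h.1]
  · have := h (Finset.mem_union_left _ hx)
    have hxR : x ∉ R := Finset.disjoint_left.1 hd hx
    simp only [Finset.mem_union, Finset.mem_erase, Finset.mem_sdiff] at this
    rcases this with (h | h) | h
    exacts [h.1 rfl, hxR (hN h), hxR h.1]

/-- If `ζ` is a supersolution of the branching recursion at every stage of the exploration at which
`P` can still hold, then it dominates the weight of the explored set. -/
theorem reachWeight_le {z ζ : Fin n ⊕ Fin m → ℝ} {P : Finset (Fin n ⊕ Fin m) → Prop}
    (hz : ∀ x, 0 ≤ z x) (hζ : ∀ x, 0 ≤ ζ x) (hP : ∀ S T, S ⊆ T → P S → P T)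
    (h : ∀ R x, P R → z x * ∫ B, ∏ y ∈ nbrs B x R, ζ y ∂bipartiteLaw n m p ≤ ζ x)
    (U R : Finset (Fin n ⊕ Fin m)) (hd : Disjoint U R) :
    reachWeight p z P U R ≤ ∏ x ∈ U, ζ x := by
  classical
  induction hk : (U ∪ R).card using Nat.strong_induction_on generalizing U R with
  | _ k ih =>
  subst hk
  rcases U.eq_empty_or_nonempty with rfl | ⟨x, hx⟩
  · unfold reachWeight
    simp only [reach_empty, Finset.prod_empty, integral_const, probReal_univ, one_smul]
    split_ifs <;> norm_num
  by_cases hPR : P R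
  · rw [reachWeight_eq_sum hd hx]
    calc _ ≤ ∑ N ∈ R.powerset,
          (∫ B, (if nbrs B x R = N then 1 else 0) ∂bipartiteLaw n m p) *
            (z x * ((∏ y ∈ U.erase x, ζ y) * ∏ y ∈ N, ζ y)) := by
          refine Finset.sum_le_sum fun N hN => ?_
          have hN := Finset.mem_powerset.1 hN
          refine mul_le_mul_of_nonneg_left (mul_le_mul_of_nonneg_left ?_ (hz x)) ?_
          · rw [← prod_erase_union hd hN]
            exact ih _ (card_step_lt hd hx hN) _ _ (disjoint_step hd x) rfl
          · exact integral_nonneg fun B => by dsimp only; split_ifs <;> norm_num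
      _ = (∏ y ∈ U.erase x, ζ y) *
          (z x * ∫ B, ∏ y ∈ nbrs B x R, ζ y ∂bipartiteLaw n m p) := by
          rw [sum_nbrs_prob_mul, integral_const_mul, integral_const_mul]
          ring
      _ ≤ (∏ y ∈ U.erase x, ζ y) * ζ x :=
          mul_le_mul_of_nonneg_left (h R x hPR) (Finset.prod_nonneg fun y _ => hζ y)
      _ = ∏ y ∈ U, ζ y := Finset.prod_erase_mul _ _ hx
  -- The unexplored set only shrinks and `P` passes to supersets, so once `P` fails it fails at the
  -- end too. Hence the supersolution inequality is needed only while `P` holds.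
  · have : reachWeight p z P U R = 0 := by
      unfold reachWeight
      refine integral_eq_zero_of_ae (Eventually.of_forall fun B => ?_)
      exact if_neg fun h' => hPR (hP _ _ Finset.sdiff_subset h')
    rw [this]
    exact Finset.prod_nonneg fun y _ => hζ y

/-- If `ζ` is a subsolution of the branching recursion, then it is dominated by the weight of the
explored set. -/
theorem le_integral_prod_reach {z ζ : Fin n ⊕ Fin m → ℝ}
    (hz : ∀ x, 0 ≤ z x) (hζ : ∀ x, 0 ≤ ζ x)
    (h : ∀ R x, ζ x ≤ z x * ∫ B, ∏ y ∈ nbrs B x R, ζ y ∂bipartiteLaw n m p)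
    (U R : Finset (Fin n ⊕ Fin m)) (hd : Disjoint U R) :
    ∏ x ∈ U, ζ x ≤ ∫ B, ∏ x ∈ reach B U R, z x ∂bipartiteLaw n m p := by
  classical
  suffices ∏ x ∈ U, ζ x ≤ reachWeight p z (fun _ => True) U R by simpa [reachWeight] using this
  induction hk : (U ∪ R).card using Nat.strong_induction_on generalizing U R with
  | _ k ih =>
  subst hk
  rcases U.eq_empty_or_nonempty with rfl | ⟨x, hx⟩
  · simp [reachWeight]
  rw [reachWeight_eq_sum hd hx]
  calc ∏ y ∈ U, ζ y = (∏ y ∈ U.erase x, ζ y) * ζ x := (Finset.prod_erase_mul _ _ hx).symm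
    _ ≤ (∏ y ∈ U.erase x, ζ y) *
        (z x * ∫ B, ∏ y ∈ nbrs B x R, ζ y ∂bipartiteLaw n m p) :=
        mul_le_mul_of_nonneg_left (h R x) (Finset.prod_nonneg fun y _ => hζ y)
    _ = ∑ N ∈ R.powerset,
        (∫ B, (if nbrs B x R = N then 1 else 0) ∂bipartiteLaw n m p) *
          (z x * ((∏ y ∈ U.erase x, ζ y) * ∏ y ∈ N, ζ y)) := by
        rw [sum_nbrs_prob_mul, integral_const_mul, integral_const_mul]
        ring
    _ ≤ _ := by
        refine Finset.sum_le_sum fun N hN => ?_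
        have hN := Finset.mem_powerset.1 hN
        refine mul_le_mul_of_nonneg_left (mul_le_mul_of_nonneg_left ?_ (hz x)) ?_
        · rw [← prod_erase_union hd hN]
          exact ih _ (card_step_lt hd hx hN) _ _ (disjoint_step hd x) rfl
        · exact integral_nonneg fun B => by dsimp only; split_ifs <;> norm_num

/-- The neighbourhood is an independent `p`-thinning of the auxiliary part of `R`, so its generating
function is a product of Bernoulli ones. -/
lemma integral_prod_nbrs_inl (ζ : Fin n ⊕ Fin m → ℝ) (v : Fin n) (R : Finset (Fin n ⊕ Fin m)) :
    ∫ B, ∏ y ∈ nbrs B (.inl v) R, ζ y ∂bipartiteLaw n m p =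
      ∏ a ∈ R.toRight, (1 + p * (ζ (.inr a) - 1)) := by
  have h : ∀ B : Bipartite n m, ∏ y ∈ nbrs B (.inl v) R, ζ y =
      ∏ e ∈ R.toRight.map ⟨fun a => (v, a), Prod.mk_right_injective v⟩,
        if B e = true then ζ (.inr e.2) else 1 := by
    intro B
    have h := Finset.prod_disjSum R.toLeft R.toRight
      fun y => if bipAdj B (.inl v) y then ζ y else 1
    have h' : (∏ y ∈ R.toLeft, if bipAdj B (.inl v) (.inl y) then ζ (.inl y) else 1) = 1 :=
      Finset.prod_eq_one fun _ _ => if_neg id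
    rw [Finset.toLeft_disjSum_toRight] at h
    rw [nbrs, Finset.prod_filter, h, h', one_mul, Finset.prod_map]
    refine Finset.prod_congr rfl fun _ _ => ?_
    simp only [bipAdj, Function.Embedding.coeFn_mk]
    congr
  refine (integral_congr_ae (Eventually.of_forall h)).trans
    ((integral_prod_edges_finset _ fun e b => if b = true then ζ (.inr e.2) else 1).trans ?_)
  rw [Finset.prod_map]
  refine Finset.prod_congr rfl fun _ _ => ?_
  simp only [Function.Embedding.coeFn_mk, if_true, Bool.false_eq_true, if_false]
  ring

lemma integral_prod_nbrs_inr (ζ : Fin n ⊕ Fin m → ℝ) (a : Fin m) (R : Finset (Fin n ⊕ Fin m)) :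
    ∫ B, ∏ y ∈ nbrs B (.inr a) R, ζ y ∂bipartiteLaw n m p =
      ∏ v ∈ R.toLeft, (1 + p * (ζ (.inl v) - 1)) := by
  have h : ∀ B : Bipartite n m, ∏ y ∈ nbrs B (.inr a) R, ζ y =
      ∏ e ∈ R.toLeft.map ⟨fun v => (v, a), Prod.mk_left_injective a⟩,
        if B e = true then ζ (.inl e.1) else 1 := by
    intro B
    have h := Finset.prod_disjSum R.toLeft R.toRight
      fun y => if bipAdj B (.inr a) y then ζ y else 1
    have h' : (∏ y ∈ R.toRight, if bipAdj B (.inr a) (.inr y) then ζ (.inr y) else 1) = 1 :=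
      Finset.prod_eq_one fun _ _ => if_neg id
    rw [Finset.toLeft_disjSum_toRight] at h
    rw [nbrs, Finset.prod_filter, h, h', mul_one, Finset.prod_map]
    refine Finset.prod_congr rfl fun _ _ => ?_
    simp only [bipAdj, Function.Embedding.coeFn_mk]
    congr
  refine (integral_congr_ae (Eventually.of_forall h)).trans
    ((integral_prod_edges_finset _ fun e b => if b = true then ζ (.inl e.1) else 1).trans ?_)
  rw [Finset.prod_map]
  refine Finset.prod_congr rfl fun _ _ => ?_
  simp only [Function.Embedding.coeFn_mk, if_true, Bool.false_eq_true, if_false]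
  ring

lemma prod_sum_elim_const {S : Finset (Fin n ⊕ Fin m)} (s t : ℝ) :
    ∏ x ∈ S, Sum.elim (fun _ => s) (fun _ => t) x = s ^ S.toLeft.card * t ^ S.toRight.card := by
  rw [← Finset.toLeft_disjSum_toRight (u := S), Finset.prod_disjSum]
  simp

open Classical in
/-- The form of `reachWeight_le` for weights that are constant on the two parts. -/
theorem integral_reach_pow_le {s t ζ η : ℝ} {P : Finset (Fin n ⊕ Fin m) → Prop}
    (hs : 0 ≤ s) (ht : 0 ≤ t) (hζ : 0 ≤ ζ) (hη : 0 ≤ η) (hP : ∀ S T, S ⊆ T → P S → P T)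
    (h1 : ∀ R, P R → s * (1 + p * (η - 1)) ^ R.toRight.card ≤ ζ)
    (h2 : ∀ R, P R → t * (1 + p * (ζ - 1)) ^ R.toLeft.card ≤ η)
    (U : Finset (Fin n)) (R : Finset (Fin n ⊕ Fin m)) (hd : Disjoint (U.map .inl) R) :
    ∫ B, (if P (R \ reach B (U.map .inl) R) then
        s ^ (reach B (U.map .inl) R).toLeft.card * t ^ (reach B (U.map .inl) R).toRight.card
      else 0) ∂bipartiteLaw n m p ≤ ζ ^ U.card := by
  have := reachWeight_le (p := p) (z := Sum.elim (fun _ => s) fun _ => t)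
    (ζ := Sum.elim (fun _ => ζ) fun _ => η) (P := P) (by rintro (_ | _) <;> simpa)
    (by rintro (_ | _) <;> simpa) hP ?_ (U.map .inl) R hd
  · simpa [reachWeight, prod_sum_elim_const] using this
  · rintro R (v | a) hR
    · simpa [integral_prod_nbrs_inl] using h1 R hR
    · simpa [integral_prod_nbrs_inr] using h2 R hR

/-- The form of `le_integral_prod_reach` for weights that are constant on the two parts. -/
theorem le_integral_reach_pow {s ζ η : ℝ} (hs : 0 ≤ s) (hζ : 0 ≤ ζ) (hη : 0 ≤ η)
    (h1 : ∀ k ≤ m, ζ ≤ s * (1 + p * (η - 1)) ^ k)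
    (h2 : ∀ k ≤ n, η ≤ (1 + p * (ζ - 1)) ^ k)
    (U : Finset (Fin n)) (R : Finset (Fin n ⊕ Fin m)) (hd : Disjoint (U.map .inl) R) :
    ζ ^ U.card ≤ ∫ B, s ^ (reach B (U.map .inl) R).toLeft.card ∂bipartiteLaw n m p := by
  have := le_integral_prod_reach (p := p) (z := Sum.elim (fun _ => s) fun _ => 1)
    (ζ := Sum.elim (fun _ => ζ) fun _ => η) (by rintro (_ | _) <;> simp [hs])
    (by rintro (_ | _) <;> simpa) ?_ (U.map .inl) R hd
  · simpa [prod_sum_elim_const] using this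
  · rintro R (v | a)
    · simpa [integral_prod_nbrs_inl] using h1 _ (R.toRight.card_le_univ.trans_eq (by simp))
    · simpa [integral_prod_nbrs_inr] using h2 _ (R.toLeft.card_le_univ.trans_eq (by simp))

end Potential

/-! ### Components of the intersection graph as explored sets. -/

section Cluster

variable {n m : ℕ} {B : Bipartite n m} {A A' : Finset (Fin m)} {U : Finset (Fin n)} {v w : Fin n}

/-- The bipartite graph `B` with all edges outside the auxiliary vertices in `A` deleted. -/
def restrictAux (A : Finset (Fin m)) (B : Bipartite n m) : Bipartite n m :=
  fun e => B e && decide (e.2 ∈ A)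

@[simp] lemma restrictAux_univ : restrictAux Finset.univ B = B := by
  funext e; simp [restrictAux]

/-- The vertices in the components of `U`, when only the auxiliary vertices in `A` are used. -/
noncomputable def cluster (B : Bipartite n m) (A : Finset (Fin m)) (U : Finset (Fin n)) :
    Finset (Fin n) :=
  (reach B (U.map .inl) (Finset.univ.disjSum A)).toLeft

lemma restrictAux_adj : (intersectionGraph (restrictAux A B)).Adj v w ↔
    v ≠ w ∧ ∃ a ∈ A, B (v, a) = true ∧ B (w, a) = true := by
  simp only [intersectionGraph, restrictAux, Bool.and_eq_true, decide_eq_true_eq]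
  exact and_congr_right fun _ => exists_congr fun a => by tauto

lemma mem_cluster : w ∈ cluster B A U ↔
    ∃ u ∈ U, (intersectionGraph (restrictAux A B)).Reachable u w := by
  classical
  constructor
  · intro hw
    -- An auxiliary vertex is remembered through a reached neighbour `w`, which makes `S` closed
    -- under single bipartite steps.
    let S : Finset (Fin n ⊕ Fin m) := Finset.univ.filter fun x => ∃ u ∈ U, ∃ w,
      (intersectionGraph (restrictAux A B)).Reachable u w ∧
        (x = .inl w ∨ ∃ a ∈ A, B (w, a) = true ∧ x = .inr a)
    have hS : reach B (U.map .inl) (Finset.univ.disjSum A) ⊆ S := by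
      refine reach_subset (fun x hx => ?_) fun x hx y hy hxy => ?_
      · obtain ⟨u, hu, rfl⟩ := Finset.mem_map.1 hx
        exact Finset.mem_filter.2 ⟨Finset.mem_univ _, u, hu, u, .refl _, .inl rfl⟩
      · obtain ⟨-, u, hu, w, huw, rfl | ⟨a, ha, hwa, rfl⟩⟩ := Finset.mem_filter.1 hx
        · rcases y with y | a
          · exact hxy.elim
          · exact Finset.mem_filter.2 ⟨Finset.mem_univ _, u, hu, w, huw,
              .inr ⟨a, by simpa using hy, hxy, rfl⟩⟩
        · rcases y with y | b
          · refine Finset.mem_filter.2 ⟨Finset.mem_univ _, u, hu, y, huw.trans ?_, .inl rfl⟩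
            by_cases hwy : w = y
            · exact hwy ▸ .refl _
            · exact (restrictAux_adj.2 ⟨hwy, a, ha, hwa, hxy⟩).reachable
          · exact hxy.elim
    obtain ⟨-, u, hu, w', huw, h | ⟨a, _, _, h⟩⟩ := Finset.mem_filter.1 (hS (Finset.mem_toLeft.1 hw))
    · exact ⟨u, hu, Sum.inl_injective h ▸ huw⟩
    · simp at h
  · rintro ⟨u, hu, huw⟩
    rw [SimpleGraph.reachable_iff_reflTransGen] at huw
    induction huw with
    | refl => exact Finset.mem_toLeft.2 (subset_reach (by simpa using hu))
    | tail _ h ih =>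
      obtain ⟨-, a, ha, h1, h2⟩ := restrictAux_adj.1 h
      refine Finset.mem_toLeft.2 (mem_reach_of_adj (x := .inr a) (mem_reach_of_adj
        (Finset.mem_toLeft.1 ih) h1 (by simpa using ha)) h2 (by simp))

lemma mem_cluster_singleton : w ∈ cluster B A {v} ↔
    (intersectionGraph (restrictAux A B)).Reachable v w := by simp [mem_cluster]

lemma cluster_mono (h : A ⊆ A') : cluster B A U ⊆ cluster B A' U :=
  Finset.toLeft_subset_toLeft (reach_mono subset_rfl (Finset.disjSum_mono subset_rfl h))

lemma cluster_eq_of_mem (h : w ∈ cluster B A {v}) : cluster B A {w} = cluster B A {v} := by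
  rw [mem_cluster_singleton] at h
  ext x
  simp only [mem_cluster_singleton]
  exact ⟨h.trans, h.symm.trans⟩

lemma cluster_pair_subset : cluster B A {v, w} ⊆ cluster B A {v} ∪ cluster B A {w} := by
  intro x
  simp only [Finset.mem_union, mem_cluster, Finset.mem_insert, Finset.mem_singleton]
  rintro ⟨u, rfl | rfl, h⟩
  exacts [.inl ⟨u, rfl, h⟩, .inr ⟨u, rfl, h⟩]

lemma dependsOn_cluster : DependsOn (fun B : Bipartite n m => cluster B A U) {e | e.2 ∈ A} := by
  intro B B' h
  have := dependsOn_reach (U := U.map .inl) (R := Finset.univ.disjSum A) (x := B) (y := B')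
    (by rintro e ⟨-, he⟩; exact h e (by simpa using he))
  simp only [cluster]
  exact congrArg Finset.toLeft this

lemma componentSize_eq (v : Fin n) :
    componentSize ((intersectionGraph B).connectedComponentMk v) =
      (cluster B Finset.univ {v}).card := by
  rw [componentSize, ← Set.ncard_coe_finset]
  congr 1
  ext w
  simp only [SimpleGraph.ConnectedComponent.mem_supp_iff, SimpleGraph.ConnectedComponent.eq,
    Finset.mem_coe, mem_cluster_singleton, restrictAux_univ]
  exact ⟨.symm, .symm⟩

/-- The set of auxiliary vertices in the components of `U`, when only those in `A` are used. -/
noncomputable def auxCluster (B : Bipartite n m) (A : Finset (Fin m)) (U : Finset (Fin n)) :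
    Finset (Fin m) :=
  (reach B (U.map .inl) (Finset.univ.disjSum A)).toRight

lemma auxCluster_subset : auxCluster B A U ⊆ A := by
  intro a ha
  have := reach_subset_union (Finset.mem_toRight.1 ha)
  simpa using this

end Cluster

/-! ### Exponential moments from super- and subsolutions. -/

section Bounds

variable {n m : ℕ} {p : unitInterval} {A : Finset (Fin m)} {U : Finset (Fin n)}

lemma one_add_mul_pow_le_exp {x : ℝ} (hx : 0 ≤ 1 + p * x) (k : ℕ) :
    (1 + p * x) ^ k ≤ Real.exp (k * p * x) := by
  calc (1 + p * x) ^ k ≤ Real.exp (p * x) ^ k := by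
        gcongr
        linarith [Real.add_one_le_exp (p * x)]
    _ = _ := by rw [← Real.exp_nat_mul]; ring_nf

/-- Exponential moments of the explored set, when there is a supersolution above `1`. -/
lemma integral_cluster_pow_le {b c s t ζ η : ℝ} (hs : 0 ≤ s) (ht : 0 ≤ t) (hζ : 1 ≤ ζ) (hη : 1 ≤ η)
    (hm : m * (p : ℝ) ≤ b) (hn : n * (p : ℝ) ≤ c)
    (h1 : s * Real.exp (b * (η - 1)) ≤ ζ) (h2 : t * Real.exp (c * (ζ - 1)) ≤ η) :
    ∫ B, s ^ (cluster B A U).card * t ^ (auxCluster B A U).card ∂bipartiteLaw n m p ≤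
      ζ ^ U.card := by
  have hp : 0 ≤ (p : ℝ) := p.2.1
  have := integral_reach_pow_le (p := p) (P := fun _ => True) hs ht (by linarith) (by linarith)
    (fun _ _ _ _ => trivial) (ζ := ζ) (η := η) (fun R _ => ?_) (fun R _ => ?_) U
    -- The exploration needs disjoint active and unseen sets; `reach_sdiff_self` removes the
    -- difference afterwards.
    (Finset.univ.disjSum A \ U.map .inl) Finset.disjoint_sdiff
  · simpa [reach_sdiff_self, cluster, auxCluster] using this
  · refine le_trans ?_ h1
    gcongr
    refine (one_add_mul_pow_le_exp (by nlinarith) _).trans (Real.exp_le_exp.2 ?_)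
    have : (R.toRight.card : ℝ) ≤ m := by exact_mod_cast R.toRight.card_le_univ.trans_eq (by simp)
    have h' : R.toRight.card * (p : ℝ) ≤ b := le_trans (by gcongr) hm
    exact mul_le_mul_of_nonneg_right h' (by linarith)
  · refine le_trans ?_ h2
    gcongr
    refine (one_add_mul_pow_le_exp (by nlinarith) _).trans (Real.exp_le_exp.2 ?_)
    have : (R.toLeft.card : ℝ) ≤ n := by exact_mod_cast R.toLeft.card_le_univ.trans_eq (by simp)
    have h' : R.toLeft.card * (p : ℝ) ≤ c := le_trans (by gcongr) hn
    exact mul_le_mul_of_nonneg_right h' (by linarith)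

open Classical in
/-- Exponential moments of the explored set while many vertices remain unexplored, when there is a
supersolution below `1`. -/
lemma integral_cluster_pow_truncated_le {N M b c s ζ η : ℝ} (hs : 0 ≤ s)
    (hζ : 0 ≤ ζ) (hζ1 : ζ ≤ 1) (hη : 0 ≤ η) (hη1 : η ≤ 1)
    (hM : b ≤ M * p) (hN : c ≤ N * p)
    (h1 : s * Real.exp (-(b * (1 - η))) ≤ ζ) (h2 : Real.exp (-(c * (1 - ζ))) ≤ η) :
    ∫ B, (if N ≤ n - (cluster B A U).card ∧ M ≤ A.card - (auxCluster B A U).card then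
      s ^ (cluster B A U).card else 0) ∂bipartiteLaw n m p ≤ ζ ^ U.card := by
  have hp : 0 ≤ (p : ℝ) := p.2.1
  have hp1 : (p : ℝ) ≤ 1 := p.2.2
  have := integral_reach_pow_le (p := p) (s := s) (t := 1) (ζ := ζ) (η := η)
    -- For weights below 1 fewer unseen vertices mean larger factors, so lower bounds on what is
    -- left are required at every step.
    (P := fun T => N ≤ T.toLeft.card ∧ M ≤ T.toRight.card) hs zero_le_one hζ hη
    (fun S T hST h => ⟨h.1.trans (by gcongr), h.2.trans (by gcongr)⟩)
    (fun R hR => ?_) (fun R hR => ?_) U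
    (Finset.univ.disjSum A \ U.map .inl) Finset.disjoint_sdiff
  · convert this using 2 with
    funext B
    have e1 : ((Finset.univ.disjSum A \ U.map .inl) \
        reach B (U.map .inl) (Finset.univ.disjSum A)).toLeft = (cluster B A U)ᶜ := by
      ext x
      simp only [Finset.mem_toLeft, Finset.mem_sdiff, Finset.inl_mem_disjSum, Finset.mem_univ,
        true_and, Finset.mem_compl, cluster]
      exact ⟨fun h => h.2, fun h => ⟨fun h' => h (subset_reach h'), h⟩⟩
    have e2 : ((Finset.univ.disjSum A \ U.map .inl) \
        reach B (U.map .inl) (Finset.univ.disjSum A)).toRight = A \ auxCluster B A U := by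
      ext x
      simp [auxCluster]
    rw [reach_sdiff_self, e1, e2, Finset.cast_card_sdiff auxCluster_subset, Finset.card_compl,
      Nat.cast_sub (Finset.card_le_univ _)]
    simp only [cluster, Fintype.card_fin, one_pow, mul_one]
    congr
  · refine le_trans ?_ h1
    gcongr
    refine (one_add_mul_pow_le_exp (by nlinarith) _).trans (Real.exp_le_exp.2 ?_)
    have h' : b ≤ R.toRight.card * (p : ℝ) := hM.trans (mul_le_mul_of_nonneg_right hR.2 hp)
    nlinarith
  · refine le_trans ?_ h2
    rw [one_mul]
    refine (one_add_mul_pow_le_exp (by nlinarith) _).trans (Real.exp_le_exp.2 ?_)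
    have h' : c ≤ R.toLeft.card * (p : ℝ) := hN.trans (mul_le_mul_of_nonneg_right hR.1 hp)
    nlinarith

/-- A converse of `1 - y ≤ exp (-y)`, from `1 - 1/x ≤ log x`. The loss κ can be taken close to 1
when `y` is small. -/
lemma exp_le_one_sub_pow {y κ : ℝ} (hy : 0 ≤ y) (hy1 : y < 1) (hκ : 1 / (1 - y) ≤ κ) (k : ℕ) :
    Real.exp (-(k * y * κ)) ≤ (1 - y) ^ k := by
  have h1 : 0 < 1 - y := by linarith
  rw [← Real.le_log_iff_exp_le (by positivity), Real.log_pow]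
  have h2 := Real.one_sub_inv_le_log_of_pos h1
  have h3 : 1 - (1 - y)⁻¹ = - (y * (1 / (1 - y))) := by field_simp; ring
  have h4 : y * (1 / (1 - y)) ≤ y * κ := by gcongr
  have h5 : -(y * κ) ≤ Real.log (1 - y) := by linarith
  calc -(k * y * κ) = k * (-(y * κ)) := by ring
    _ ≤ _ := by gcongr

/-- Lower bound on the generating function of the size of the explored set, when there is a
subsolution below `1`. -/
lemma le_integral_cluster_pow {b c s ζ η κ : ℝ} (hs : 0 ≤ s)
    (hζ : 0 ≤ ζ) (hζ1 : ζ ≤ 1) (hη : 0 ≤ η) (hη1 : η ≤ 1)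
    (hp1 : (p : ℝ) < 1) (hκ : 1 / (1 - (p : ℝ)) ≤ κ)
    (hm : m * (p : ℝ) ≤ b) (hn : n * (p : ℝ) ≤ c)
    (h1 : ζ ≤ s * Real.exp (-(b * (1 - η) * κ))) (h2 : η ≤ Real.exp (-(c * (1 - ζ) * κ))) :
    ζ ^ U.card ≤ ∫ B, s ^ (cluster B A U).card ∂bipartiteLaw n m p := by
  have hp : 0 ≤ (p : ℝ) := p.2.1
  have hκ0 : 0 ≤ κ := le_trans (by rw [one_div]; exact inv_nonneg.2 (by linarith)) hκ
  have key : ∀ (x : ℝ) (b : ℝ) (k l : ℕ), 0 ≤ x → x ≤ 1 → l * (p : ℝ) ≤ b → k ≤ l →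
      Real.exp (-(b * (1 - x) * κ)) ≤ (1 + p * (x - 1)) ^ k := by
    intro x b k l hx hx1 hb hk
    have hxp : p * (1 - x) ≤ (p : ℝ) := by nlinarith
    have hy0 : 0 ≤ p * (1 - x) := by apply mul_nonneg hp; linarith
    have := exp_le_one_sub_pow hy0 (by linarith) (κ := κ) (le_trans (by
      apply one_div_le_one_div_of_le <;> linarith) hκ) k
    refine le_trans (Real.exp_le_exp.2 ?_) (this.trans_eq (by ring_nf))
    have hk' : (k : ℝ) ≤ l := by exact_mod_cast hk
    have : k * (p : ℝ) ≤ b := le_trans (by gcongr) hb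
    have h3 : k * (p : ℝ) * ((1 - x) * κ) ≤ b * ((1 - x) * κ) :=
      mul_le_mul_of_nonneg_right this (mul_nonneg (by linarith) hκ0)
    linarith
  have := le_integral_reach_pow (p := p) (ζ := ζ) (η := η) hs hζ hη
    (fun k hk => h1.trans ?_) (fun k hk => h2.trans ?_) U
    (Finset.univ.disjSum A \ U.map .inl) Finset.disjoint_sdiff
  · simpa only [reach_sdiff_self, cluster] using this
  · exact mul_le_mul_of_nonneg_left (key η b k m hη hη1 hm hk) hs
  · exact key ζ c k n hζ hζ1 hn hk

end Bounds

/-! ### Fixed points of the compound Poisson generating function. -/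

section GeneratingFunction

lemma hasDerivAt_cpoissonGF (a b s : ℝ) :
    HasDerivAt (cpoissonGF a b) (cpoissonGF a b s * (a * (Real.exp (b * (s - 1)) * b))) s := by
  have h1 : HasDerivAt (fun s => b * (s - 1)) b s := by
    simpa using ((hasDerivAt_id s).sub_const 1).const_mul b
  exact ((h1.exp.sub_const 1).const_mul a).exp

lemma continuous_cpoissonGF (a b : ℝ) : Continuous (cpoissonGF a b) := by
  unfold cpoissonGF; fun_prop

@[simp] lemma cpoissonGF_one (a b : ℝ) : cpoissonGF a b 1 = 1 := by simp [cpoissonGF]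

lemma cpoissonGF_pos (a b s : ℝ) : 0 < cpoissonGF a b s := Real.exp_pos _

/-- The limit is μ - 1 in the application; its sign decides on which side of 1 the function dips
below the diagonal. -/
lemma tendsto_slope_cpoissonGF_sub_self (a b : ℝ) :
    Tendsto (slope (fun s => cpoissonGF a b s - s) 1) (𝓝[≠] 1) (𝓝 (a * b - 1)) := by
  have h := (hasDerivAt_cpoissonGF a b 1).sub (hasDerivAt_id (1 : ℝ))
  simp only [cpoissonGF_one, sub_self, mul_zero, Real.exp_zero, one_mul] at h
  exact hasDerivAt_iff_tendsto_slope.1 h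

lemma exists_gt_one_cpoissonGF_lt {a b : ℝ} (h : a * b < 1) : ∃ s > 1, cpoissonGF a b s < s := by
  have h1 := (tendsto_slope_cpoissonGF_sub_self a b).eventually_lt_const (sub_neg.2 h)
  obtain ⟨s, hs, hs1⟩ := ((h1.filter_mono (nhdsWithin_mono 1
    (s := Set.Ioi 1) fun x hx => (Set.mem_Ioi.1 hx).ne')).and self_mem_nhdsWithin).exists
  refine ⟨s, hs1, ?_⟩
  have hs1 : 1 < s := hs1
  rw [slope_def_field, div_neg_iff] at hs
  simp only [cpoissonGF_one, sub_self, sub_zero] at hs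
  rcases hs with hs | hs <;> linarith

lemma exists_lt_one_cpoissonGF_lt {a b : ℝ} (h : 1 < a * b) :
    ∃ s, 0 < s ∧ s < 1 ∧ cpoissonGF a b s < s := by
  have h1 := (tendsto_slope_cpoissonGF_sub_self a b).eventually_const_lt (sub_pos.2 h)
  have h0 : ∀ᶠ s : ℝ in 𝓝[<] 1, 0 < s :=
    (lt_mem_nhds (zero_lt_one (α := ℝ))).filter_mono nhdsWithin_le_nhds
  obtain ⟨s, ⟨hs, hs0⟩, hs1⟩ := (((h1.filter_mono
    (nhdsWithin_mono 1 (s := Set.Iio 1) fun x hx => (Set.mem_Iio.1 hx).ne)).and h0).and self_mem_nhdsWithin).exists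
  refine ⟨s, hs0, hs1, ?_⟩
  have hs1 : s < 1 := hs1
  rw [slope_def_field, div_pos_iff] at hs
  simp only [cpoissonGF_one, sub_self, sub_zero] at hs
  rcases hs with hs | hs <;> linarith

/-- In the supercritical case, the smallest fixed point `ρ` of the generating function lies strictly
between `0` and `1`; the generating function is above the diagonal to the left of `ρ` and below it between `ρ` and
`1`. -/
lemma exists_isLeast_fixedPoint {a b : ℝ} (ha : 0 < a) (h : 1 < a * b) :
    ∃ ρ, IsLeast {s : ℝ | 0 ≤ s ∧ s = cpoissonGF a b s} ρ ∧ 0 < ρ ∧ ρ < 1 ∧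
      (∀ s, 0 ≤ s → s < ρ → s < cpoissonGF a b s) ∧
      (∀ s, ρ < s → s < 1 → cpoissonGF a b s < s) := by
  set F : Set ℝ := {s : ℝ | 0 ≤ s ∧ s = cpoissonGF a b s} with hF
  have hclosed : IsClosed F :=
    isClosed_Ici.inter (isClosed_eq continuous_id (continuous_cpoissonGF a b))
  have hbdd : BddBelow F := ⟨0, fun s hs => hs.1⟩
  have hleast : IsLeast F (sInf F) := hclosed.isLeast_csInf ⟨1, by simp [hF]⟩ hbdd
  set ρ := sInf F
  have hcont : Continuous fun s => cpoissonGF a b s - s :=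
    (continuous_cpoissonGF a b).sub continuous_id
  -- The function is positive at 0, so reaching the diagonal or going below it forces a fixed point
  -- in `[0, s]`.
  have hfix : ∀ s, 0 ≤ s → cpoissonGF a b s ≤ s → ρ ≤ s := by
    intro s hs hgs
    obtain ⟨x, hx, hx0⟩ := intermediate_value_Icc' hs hcont.continuousOn
      (show (0 : ℝ) ∈ Set.Icc _ _ from
        ⟨by linarith, by simpa using (cpoissonGF_pos a b 0).le⟩)
    exact (hleast.2 ⟨hx.1, by dsimp only at hx0; linarith⟩).trans hx.2
  have hρ0 : 0 < ρ := hleast.1.2 ▸ cpoissonGF_pos a b _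
  have hρ1 : ρ < 1 := by
    obtain ⟨s, hs0, hs1, hs⟩ := exists_lt_one_cpoissonGF_lt h
    exact (hfix s hs0.le hs.le).trans_lt hs1
  refine ⟨ρ, hleast, hρ0, hρ1, fun s hs hsρ => ?_, fun s hρs hs1 => ?_⟩
  · by_contra! hle
    exact absurd (hfix s hs hle) (not_le.2 hsρ)
  -- The logarithm of the generating function is convex, `log` is strictly concave, and the two
  -- agree at ρ and at 1. Here `u` and `w` are the barycentric coordinates of `s` in `[ρ, 1]`.
  · have hs0 : 0 < s := hρ0.trans hρs
    have hlogρ : Real.log ρ = a * (Real.exp (b * (ρ - 1)) - 1) := by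
      conv_lhs => rw [hleast.1.2, cpoissonGF, Real.log_exp]
    set u := (1 - s) / (1 - ρ) with hu
    set w := (s - ρ) / (1 - ρ) with hw
    have hd : 0 < 1 - ρ := by linarith
    have hu0 : 0 < u := div_pos (by linarith) hd
    have hw0 : 0 < w := div_pos (by linarith) hd
    have huw : u + w = 1 := by rw [hu, hw]; field_simp; ring
    have hcomb : u * ρ + w * 1 = s := by rw [hu, hw]; field_simp; ring
    have h1 := strictConcaveOn_log_Ioi.2 (show ρ ∈ Set.Ioi (0 : ℝ) from Set.mem_Ioi.2 hρ0)
      (show (1 : ℝ) ∈ Set.Ioi (0 : ℝ) from Set.mem_Ioi.2 one_pos) hρ1.ne hu0 hw0 huw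
    simp only [smul_eq_mul, Real.log_one, mul_zero, add_zero, hcomb] at h1
    have h2 := convexOn_exp.2 (Set.mem_univ (b * (ρ - 1))) (Set.mem_univ (0 : ℝ)) hu0.le hw0.le huw
    have h3 : u * (b * (ρ - 1)) + w * 0 = b * (s - 1) := by
      rw [← hcomb]; linear_combination -b * huw
    simp only [smul_eq_mul, h3, Real.exp_zero] at h2
    rw [cpoissonGF, ← Real.lt_log_iff_exp_lt hs0]
    calc a * (Real.exp (b * (s - 1)) - 1)
        ≤ a * (u * Real.exp (b * (ρ - 1)) + w * 1 - 1) := by gcongr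
      _ = u * Real.log ρ := by rw [hlogρ]; linear_combination a * huw
      _ < Real.log s := h1

end GeneratingFunction

/-! ### Tail bounds for component sizes. -/

section Tails

lemma measureReal_le_integral_div {n m : ℕ} {p : unitInterval} {E : Set (Bipartite n m)}
    {F : Bipartite n m → ℝ} {c : ℝ} (hc : 0 < c) (hF : ∀ B, 0 ≤ F B) (hE : ∀ B ∈ E, c ≤ F B) :
    (bipartiteLaw n m p).real E ≤ (∫ B, F B ∂bipartiteLaw n m p) / c := by
  rw [le_div_iff₀' hc]
  refine le_trans ?_ (mul_meas_ge_le_integral_of_nonneg (Eventually.of_forall hF)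
    (integrable_bipartiteLaw F) c)
  exact mul_le_mul_of_nonneg_left (measureReal_mono fun B hB => hE B hB) hc.le

lemma subcritical_tail {β γ : ℝ} (hγ : 0 < γ) (h : β * γ ^ 2 < 1) :
    ∃ ζ > 0, ∃ s > 1, ∀ (n m : ℕ) (p : unitInterval), m * (p : ℝ) ≤ β * γ → n * (p : ℝ) ≤ γ →
      ∀ (v : Fin n) (x : ℝ),
        (bipartiteLaw n m p).real {B | x ≤ (cluster B Finset.univ {v}).card} ≤ ζ * s ^ (-x) := by
  obtain ⟨ζ, hζ, hgζ⟩ := exists_gt_one_cpoissonGF_lt (a := β * γ) (b := γ) (by linarith [h])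
  -- This base `s` turns the recursion at ζ into an equality; the tail is then Markov's inequality
  -- for `s ^ |cluster|`.
  have hs : 1 < ζ / cpoissonGF (β * γ) γ ζ := (one_lt_div (cpoissonGF_pos _ _ _)).2 hgζ
  refine ⟨ζ, by linarith, _, hs, fun n m p hm hn v x => ?_⟩
  set s := ζ / cpoissonGF (β * γ) γ ζ
  have h1 := integral_cluster_pow_le (A := Finset.univ) (U := {v}) (s := s) (t := 1) (ζ := ζ)
    (η := Real.exp (γ * (ζ - 1))) (by linarith) zero_le_one hζ.le
    (Real.one_le_exp (mul_nonneg hγ.le (by linarith))) hm hn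
    (div_mul_cancel₀ _ (cpoissonGF_pos _ _ _).ne').le (by rw [one_mul])
  have h2 := measureReal_le_integral_div (n := n) (m := m) (p := p) (E := {B | x ≤ (cluster B Finset.univ {v}).card})
    (F := fun B => s ^ (cluster B Finset.univ {v}).card * 1 ^ (auxCluster B Finset.univ {v}).card)
    (c := s ^ x) (Real.rpow_pos_of_pos (by linarith) _) (fun B => by positivity) ?_
  · refine h2.trans ?_
    rw [Real.rpow_neg (by linarith), ← div_eq_mul_inv]
    gcongr
    simpa using h1
  · intro B hB
    rw [one_pow, mul_one, ← Real.rpow_natCast]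
    exact Real.rpow_le_rpow_of_exponent_le hs.le hB

/-- By continuity the strict inequality leaves room `x` for two things: a weight above 1 per vertex,
and the loss of `x * n` vertices and `x * n` auxiliary vertices. -/
lemma exists_supersolution {β γ ζ : ℝ} (hβ : 0 < β) (hg : cpoissonGF (β * γ) γ ζ < ζ) :
    ∃ x, 0 < x ∧ x < 1 ∧ x < β ∧
      (1 + x) * Real.exp (-((β - x) * γ * (1 - Real.exp (-((1 - x) * γ * (1 - ζ)))))) ≤ ζ := by
  have hc : Continuous fun x : ℝ => (1 + x) *
      Real.exp (-((β - x) * γ * (1 - Real.exp (-((1 - x) * γ * (1 - ζ)))))) := by fun_prop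
  have h0 := (hc.tendsto 0).eventually_lt_const (u := ζ) (by
    refine lt_of_eq_of_lt ?_ hg
    simp only [cpoissonGF, add_zero, one_mul, sub_zero]
    congr 1
    rw [show -(γ * (1 - ζ)) = γ * (ζ - 1) by ring]
    ring)
  have h1 : ∀ᶠ x : ℝ in 𝓝 0, x < min 1 β := gt_mem_nhds (by simp [hβ])
  obtain ⟨x, ⟨hx, hx1⟩, hx0⟩ := (((h0.and h1).filter_mono (nhdsWithin_le_nhds
    (s := Set.Ioi 0))).and self_mem_nhdsWithin).exists
  exact ⟨x, hx0, hx1.trans_le (min_le_left _ _), hx1.trans_le (min_le_right _ _), hx.le⟩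

/-- The factors `1 + x` absorb the κ of `exp_le_one_sub_pow`. -/
lemma exists_subsolution {β γ ζ : ℝ} (hg : ζ < cpoissonGF (β * γ) γ ζ) :
    ∃ x, 0 < x ∧ x < 1 ∧
      ζ ≤ (1 - x) *
        Real.exp (-(β * γ * (1 - Real.exp (-(γ * (1 - ζ) * (1 + x)))) * (1 + x))) := by
  have hc : Continuous fun x : ℝ => (1 - x) *
      Real.exp (-(β * γ * (1 - Real.exp (-(γ * (1 - ζ) * (1 + x)))) * (1 + x))) := by fun_prop
  have h0 := (hc.tendsto 0).eventually_const_lt (u := ζ) (by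
    refine lt_of_lt_of_eq hg ?_
    simp only [cpoissonGF, add_zero, one_mul, sub_zero, mul_one]
    congr 1
    rw [show -(γ * (1 - ζ)) = γ * (ζ - 1) by ring]
    ring)
  have h1 : ∀ᶠ x : ℝ in 𝓝 0, x < 1 := gt_mem_nhds one_pos
  obtain ⟨x, ⟨hx, hx1⟩, hx0⟩ := (((h0.and h1).filter_mono (nhdsWithin_le_nhds
    (s := Set.Ioi 0))).and self_mem_nhdsWithin).exists
  exact ⟨x, hx0, hx1, hx.le⟩

/-- Few vertices are unlikely to have many auxiliary neighbours. -/
lemma aux_tail {β γ : ℝ} (hβ : 0 < β) (hγ : 0 < γ) {x : ℝ} (hx : 0 < x) :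
    ∃ δ > (0 : ℝ), ∃ c > (0 : ℝ), ∀ (n m : ℕ) (p : unitInterval), m * (p : ℝ) ≤ β * γ → n * (p : ℝ) ≤ γ →
      ∀ (A : Finset (Fin m)) (U : Finset (Fin n)),
        (bipartiteLaw n m p).real {B | (cluster B A U).card ≤ δ * n ∧
          x * n ≤ (auxCluster B A U).card} ≤ 2 ^ U.card * Real.exp (-(c * n)) := by
  -- Auxiliary vertices get weight 2 and vertices the penalty `exp (-M)`, with ζ = 2; η and `M` are
  -- what the recursion then demands. δ is chosen so that the penalty uses at most half of the gain.
  set η := 2 * Real.exp γ with hη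
  have hη1 : 1 ≤ η := by have := Real.one_le_exp hγ.le; linarith
  set M := β * γ * (η - 1) with hM
  have hM0 : 0 ≤ M := mul_nonneg (by positivity) (by linarith)
  have hl2 : 0 < Real.log 2 := Real.log_pos one_lt_two
  refine ⟨x * Real.log 2 / (2 * (M + 1)), by positivity, x * Real.log 2 / 2, by positivity,
    fun n m p hm hn A U => ?_⟩
  set δ := x * Real.log 2 / (2 * (M + 1)) with hδ
  have hδ0 : 0 < δ := by positivity
  have hMδ : M * δ ≤ x * Real.log 2 / 2 := by
    have : (M + 1) * δ = x * Real.log 2 / 2 := by rw [hδ]; field_simp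
    nlinarith
  have h1 := integral_cluster_pow_le (A := A) (U := U) (s := Real.exp (-M)) (t := 2) (ζ := 2)
    (η := η) (Real.exp_pos _).le zero_le_two one_le_two hη1 hm hn
    (by rw [← Real.exp_add, ← hM]; simp) (by rw [hη]; norm_num)
  have h2 := measureReal_le_integral_div (n := n) (m := m) (p := p)
    (E := {B | (cluster B A U).card ≤ δ * n ∧ x * n ≤ (auxCluster B A U).card})
    (F := fun B => Real.exp (-M) ^ (cluster B A U).card * 2 ^ (auxCluster B A U).card)
    (c := Real.exp (x * Real.log 2 / 2 * n)) (Real.exp_pos _) (fun B => by positivity) ?_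
  · refine h2.trans ?_
    rw [Real.exp_neg (_ * (n : ℝ)), ← div_eq_mul_inv]
    gcongr
  · rintro B ⟨hB1, hB2⟩
    have : Real.exp (-M) ^ (cluster B A U).card * 2 ^ (auxCluster B A U).card =
        Real.exp ((auxCluster B A U).card * Real.log 2 - (cluster B A U).card * M) := by
      rw [sub_eq_add_neg, Real.exp_add, ← mul_neg (_ : ℝ) M, Real.exp_nat_mul, Real.exp_nat_mul,
        Real.exp_log two_pos, mul_comm]
    rw [this]
    apply Real.exp_le_exp.2
    have h3 := mul_le_mul_of_nonneg_right hB2 hl2.le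
    have h4 := mul_le_mul_of_nonneg_right hB1 hM0
    have h5 := mul_le_mul_of_nonneg_right hMδ (Nat.cast_nonneg (α := ℝ) n)
    linarith

/-- If `g ζ < ζ < 1`, components are unlikely to be of intermediate size, even when a small
proportion of the auxiliary vertices is deleted. -/
theorem cluster_gap {β γ ζ : ℝ} (hβ : 0 < β) (hγ : 0 < γ) (hζ : 0 < ζ) (hζ1 : ζ < 1)
    (hg : cpoissonGF (β * γ) γ ζ < ζ) :
    ∃ δ > (0 : ℝ), ∃ s > 1, ∃ c > (0 : ℝ), ∃ b < β, ∀ (n m : ℕ) (p : unitInterval),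
      m * (p : ℝ) ≤ β * γ → n * (p : ℝ) = γ →
      ∀ (A : Finset (Fin m)) (U : Finset (Fin n)) (x : ℝ), b * n ≤ A.card →
        (bipartiteLaw n m p).real {B | x ≤ (cluster B A U).card ∧ (cluster B A U).card ≤ δ * n} ≤
          ζ ^ U.card * s ^ (-x) + 2 ^ U.card * Real.exp (-(c * n)) := by
  classical
  obtain ⟨y, hy0, hy1, hyβ, hy⟩ := exists_supersolution hβ hg
  -- Half of the slack `y` in auxiliary vertices is spent on deletions, the other half on those
  -- explored.
  obtain ⟨δ, hδ, c, hc, htail⟩ := aux_tail hβ hγ (half_pos hy0)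
  refine ⟨min δ y, lt_min hδ hy0, 1 + y, by linarith, c, hc, β - y / 2, by linarith,
    fun n m p hm hn A U x hA => ?_⟩
  set η := Real.exp (-((1 - y) * γ * (1 - ζ))) with hη
  have hη1 : η ≤ 1 := Real.exp_le_one_iff.2 (by
    have : 0 ≤ (1 - y) * γ * (1 - ζ) := by
      apply mul_nonneg (mul_nonneg _ hγ.le) <;> linarith
    linarith)
  have h1 := integral_cluster_pow_truncated_le (n := n) (p := p) (A := A) (U := U)
    (N := (1 - y) * n) (M := (β - y) * n)
    (s := 1 + y) (ζ := ζ) (η := η) (b := (β - y) * γ) (c := (1 - y) * γ)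
    (by linarith) hζ.le hζ1.le (Real.exp_pos _).le hη1 (by rw [← hn]; linarith)
    (by rw [← hn]; linarith) hy le_rfl
  have h2 := measureReal_le_integral_div (n := n) (m := m) (p := p)
    (E := {B | x ≤ (cluster B A U).card ∧ (1 - y) * n ≤ n - (cluster B A U).card ∧
      (β - y) * n ≤ A.card - (auxCluster B A U).card})
    (F := fun B => if (1 - y) * n ≤ n - (cluster B A U).card ∧
      (β - y) * n ≤ A.card - (auxCluster B A U).card then (1 + y) ^ (cluster B A U).card else 0)
    (c := (1 + y) ^ x) (Real.rpow_pos_of_pos (by linarith) _)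
    (fun B => by split_ifs <;> positivity) ?_
  · have h3 := htail n m p hm hn.le A U
    have hsub : {B : Bipartite n m | x ≤ (cluster B A U).card ∧
        (cluster B A U).card ≤ min δ y * n} ⊆
        {B | x ≤ (cluster B A U).card ∧ (1 - y) * n ≤ n - (cluster B A U).card ∧
          (β - y) * n ≤ A.card - (auxCluster B A U).card} ∪
        {B | (cluster B A U).card ≤ δ * n ∧ y / 2 * n ≤ (auxCluster B A U).card} := by
      rintro B ⟨hB1, hB2⟩
      have hn0 : (0 : ℝ) ≤ n := Nat.cast_nonneg n
      have e1 : min δ y * n ≤ δ * n := by gcongr; exact min_le_left _ _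
      have e2 : min δ y * n ≤ y * n := by gcongr; exact min_le_right _ _
      by_cases hB3 : y / 2 * n ≤ (auxCluster B A U).card
      · exact .inr ⟨hB2.trans e1, hB3⟩
      · refine .inl ⟨hB1, by linarith, ?_⟩
        push Not at hB3
        linarith
    refine (measureReal_mono hsub).trans ((measureReal_union_le _ _).trans (add_le_add ?_ h3))
    refine h2.trans ?_
    rw [Real.rpow_neg (by linarith), ← div_eq_mul_inv]
    gcongr
  · rintro B ⟨hB1, hB2⟩
    rw [if_pos hB2, ← Real.rpow_natCast]
    exact Real.rpow_le_rpow_of_exponent_le (by linarith) hB1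

/-- If `ζ < g ζ`, then the probability of a small component is eventually at least about `ζ`. -/
theorem le_measureReal_small_cluster {β γ ζ : ℝ} (hγ : 0 < γ) (hζ : 0 ≤ ζ) (hζ1 : ζ < 1)
    (hg : ζ < cpoissonGF (β * γ) γ ζ) :
    ∃ s, 0 < s ∧ s < 1 ∧ ∃ p₀ > 0, ∀ (n m : ℕ) (p : unitInterval), (p : ℝ) ≤ p₀ →
      m * (p : ℝ) ≤ β * γ → n * (p : ℝ) ≤ γ →
      ∀ (A : Finset (Fin m)) (v : Fin n) (x : ℝ),
        ζ - s ^ x ≤ (bipartiteLaw n m p).real {B | (cluster B A {v}).card ≤ x} := by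
  classical
  obtain ⟨y, hy0, hy1, hy⟩ := exists_subsolution hg
  -- The threshold `y / (1 + y)` is where `1 / (1 - p)` equals `1 + y`.
  refine ⟨1 - y, by linarith, by linarith, y / (1 + y), by positivity,
    fun n m p hp hm hn A v x => ?_⟩
  have hp1 : 1 - (p : ℝ) ≥ 1 / (1 + y) := by
    have : 1 - y / (1 + y) = 1 / (1 + y) := by field_simp; ring
    linarith
  have hy' : 0 < 1 / (1 + y) := by positivity
  have h1 := le_integral_cluster_pow (p := p) (A := A) (U := {v}) (s := 1 - y) (κ := 1 + y)
    (by linarith) hζ hζ1.le (Real.exp_pos _).le (Real.exp_le_one_iff.2 (by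
      have : 0 ≤ γ * (1 - ζ) * (1 + y) := by
        apply mul_nonneg (mul_nonneg hγ.le _) <;> linarith
      linarith)) (by linarith) (by
        rw [one_div_le (by linarith) (by linarith)]; exact hp1) hm hn hy le_rfl
  rw [Finset.card_singleton, pow_one] at h1
  -- The integrand is at most 1 on clusters of size up to `x` and at most `(1 - y) ^ x` on larger
  -- ones.
  have h2 : ∫ B, (1 - y) ^ (cluster B A {v}).card ∂bipartiteLaw n m p ≤
      ∫ B, ({B | ((cluster B A {v}).card : ℝ) ≤ x}.indicator 1 B + (1 - y) ^ x)
        ∂bipartiteLaw n m p := by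
    refine integral_mono (integrable_bipartiteLaw _) (integrable_bipartiteLaw _) fun B => ?_
    have hpos : 0 < (1 - y) ^ x := Real.rpow_pos_of_pos (by linarith) x
    by_cases hB : ((cluster B A {v}).card : ℝ) ≤ x
    · simp only [Set.indicator, Set.mem_ofPred_eq, hB, if_true, Pi.one_apply]
      have := pow_le_one₀ (n := (cluster B A {v}).card) (show 0 ≤ 1 - y by linarith) (by linarith)
      linarith
    · simp only [Set.indicator, Set.mem_ofPred_eq, hB, if_false, zero_add]
      rw [← Real.rpow_natCast]
      exact Real.rpow_le_rpow_of_exponent_ge (by linarith) (by linarith) (not_le.1 hB).le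
  rw [integral_add (integrable_bipartiteLaw _) (integrable_bipartiteLaw _),
    integral_indicator_one (Set.toFinite _).measurableSet] at h2
  simp only [integral_const, probReal_univ, one_smul] at h2
  linarith

end Tails

/-! ### Joining large clusters through reserved auxiliary vertices. -/

section Sprinkling

variable {n m : ℕ} {p : unitInterval}

/-- Conditioning on `X`: a bound for every frozen value survives substituting the random one,
because `F` reads only edges independent of `X`. -/
lemma integral_comp_le_of_dependsOn {α : Type*} [Fintype α] [DecidableEq α]
    {S T : Set (Fin n × Fin m)} (hST : Disjoint S T) {X : Bipartite n m → α} (hX : DependsOn X S)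
    {F : α → Bipartite n m → ℝ} (hF : ∀ N, DependsOn (F N) T) {q : ℝ}
    (hq : ∀ N, ∫ B, F N B ∂bipartiteLaw n m p ≤ q) :
    ∫ B, F (X B) B ∂bipartiteLaw n m p ≤ q := by
  rw [integral_fiberwise Finset.univ X (fun _ => Finset.mem_univ _) F]
  calc _ ≤ ∑ N, ∫ B, (if X B = N then 1 else 0) * q ∂bipartiteLaw n m p := by
        refine Finset.sum_le_sum fun N _ => ?_
        rw [integral_mul_of_dependsOn hST (fun B B' h => by simp only [hX h]) (hF N),
          integral_mul_const]
        refine mul_le_mul_of_nonneg_left (hq N) (integral_nonneg fun B => ?_)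
        dsimp only
        split_ifs <;> norm_num
    _ = q := by
        rw [← integral_fiberwise (p := p) Finset.univ X (fun _ => Finset.mem_univ _) fun _ _ => q]
        simp

lemma integral_prod_of_dependsOn_columns (D : Finset (Fin m)) {f : Fin m → Bipartite n m → ℝ}
    (hf : ∀ a, DependsOn (f a) {e | e.2 = a}) :
    ∫ B, ∏ a ∈ D, f a B ∂bipartiteLaw n m p = ∏ a ∈ D, ∫ B, f a B ∂bipartiteLaw n m p := by
  classical
  induction D using Finset.induction_on with
  | empty => simp
  | insert a D ha ih =>
    simp only [Finset.prod_insert ha]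
    rw [integral_mul_of_dependsOn (S := {e | e.2 = a}) (T := {e | e.2 ∈ D}) _ (hf a), ih]
    · intro B B' h
      refine Finset.prod_congr rfl fun b hb => hf b fun e he => h e ?_
      obtain rfl : e.2 = b := he
      exact hb
    · rw [Set.disjoint_left]
      intro e he he'
      exact ha ((show e.2 = a from he) ▸ he')

/-- The indicator of the event that the auxiliary vertex `a` has no neighbour in `S`. -/
def avoids (S : Finset (Fin n)) (a : Fin m) (B : Bipartite n m) : ℝ :=
  ∏ v ∈ S, if B (v, a) = true then 0 else 1

variable {S T : Finset (Fin n)} {a : Fin m}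

lemma avoids_eq_one {B : Bipartite n m} (h : ∀ v ∈ S, ¬ B (v, a) = true) : avoids S a B = 1 :=
  Finset.prod_eq_one fun v hv => if_neg (h v hv)

lemma avoids_mem_Icc (B : Bipartite n m) : 0 ≤ avoids S a B ∧ avoids S a B ≤ 1 :=
  ⟨Finset.prod_nonneg fun v _ => by split_ifs <;> norm_num,
    Finset.prod_le_one (fun v _ => by split_ifs <;> norm_num) fun v _ => by split_ifs <;> norm_num⟩

lemma dependsOn_avoids :
    DependsOn (avoids (n := n) S a) {e | e.1 ∈ S ∧ e.2 = a} := by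
  intro B B' h
  exact Finset.prod_congr rfl fun v hv => by rw [h (v, a) ⟨hv, rfl⟩]

lemma integral_avoids :
    ∫ B, avoids S a B ∂bipartiteLaw n m p = (1 - p) ^ S.card := by
  have h := integral_prod_edges_finset (p := p)
    (S.map ⟨fun v => (v, a), Prod.mk_left_injective a⟩) fun _ b => if b = true then 0 else 1
  simpa [avoids, Finset.prod_map] using h

/-- Vertices in two large components of the graph spanned by the auxiliary vertices in `A` are
likely to be joined through one of the other auxiliary vertices. -/
lemma sprinkling (A : Finset (Fin m)) (v w : Fin n) {d : ℝ} (hd : 0 ≤ d) :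
    (bipartiteLaw n m p).real {B | d ≤ (cluster B A {v}).card ∧ d ≤ (cluster B A {w}).card ∧
      w ∉ cluster B Finset.univ {v}} ≤
      (1 - (1 - Real.exp (-(p * d))) ^ 2) ^ (Aᶜ).card := by
  classical
  have hp : 0 ≤ (p : ℝ) := p.2.1
  have hp1 : (p : ℝ) ≤ 1 := p.2.2
  set r := Real.exp (-(p * d)) with hr
  have hr1 : r ≤ 1 := Real.exp_le_one_iff.2 (by have := mul_nonneg hp hd; linarith)
  have hr0 : 0 < r := Real.exp_pos _
  set q := 1 - (1 - r) ^ 2 with hq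
  have hq0 : 0 ≤ q := by rw [hq]; nlinarith
  -- By inclusion–exclusion, the indicator that `a` misses one of the two sets and so does not join
  -- them.
  let f : Finset (Fin n) × Finset (Fin n) → Fin m → Bipartite n m → ℝ := fun N a B =>
    avoids N.1 a B + avoids N.2 a B - avoids N.1 a B * avoids N.2 a B
  have hf0 : ∀ N a B, 0 ≤ f N a B := fun N a B => by
    have h1 := avoids_mem_Icc (S := N.1) (a := a) B
    have h2 := avoids_mem_Icc (S := N.2) (a := a) B
    simp only [f]
    nlinarith
  have hfd : ∀ N a, DependsOn (f N a) {e | e.2 = a} := fun N a B B' h => by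
    simp only [f]
    rw [dependsOn_avoids (S := N.1) fun e he => h e he.2,
      dependsOn_avoids (S := N.2) fun e he => h e he.2]
  -- Disjointness makes the two avoidance events independent. It costs nothing: clusters that meet
  -- already connect `v` and `w`.
  let F : Finset (Fin n) × Finset (Fin n) → Bipartite n m → ℝ := fun N B =>
    if d ≤ N.1.card ∧ d ≤ N.2.card ∧ Disjoint N.1 N.2 then ∏ a ∈ Aᶜ, f N a B else 0
  have hF : ∀ N, ∫ B, F N B ∂bipartiteLaw n m p ≤ q ^ (Aᶜ).card := by
    intro N
    by_cases hN : d ≤ N.1.card ∧ d ≤ N.2.card ∧ Disjoint N.1 N.2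
    · simp only [F, if_pos hN]
      rw [integral_prod_of_dependsOn_columns _ (hfd N)]
      rw [← Finset.prod_const]
      refine Finset.prod_le_prod (fun a _ => integral_nonneg (hf0 N a)) fun a _ => ?_
      have hmul := integral_mul_of_dependsOn (p := p) (f := avoids (n := n) N.1 a)
        (g := avoids N.2 a) ?_ dependsOn_avoids dependsOn_avoids
      · simp only [f]
        rw [integral_sub (integrable_bipartiteLaw _) (integrable_bipartiteLaw _),
          integral_add (integrable_bipartiteLaw _) (integrable_bipartiteLaw _), hmul,
          integral_avoids, integral_avoids]
        have hpow : ∀ k : ℕ, d ≤ k → (1 - (p : ℝ)) ^ k ≤ r := fun k hk => by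
          have := one_add_mul_pow_le_exp (p := p) (x := -1) (by linarith) k
          refine le_trans (by ring_nf; rfl) (this.trans (Real.exp_le_exp.2 ?_))
          nlinarith
        have h1 := hpow _ hN.1
        have h2 := hpow _ hN.2.1
        nlinarith [mul_le_mul (sub_le_sub_left h1 1) (sub_le_sub_left h2 1) (by linarith)
          (by linarith)]
      · rw [Set.disjoint_left]
        intro e he he'
        exact Finset.disjoint_left.1 hN.2.2 he.1 he'.1
    · simp only [F, if_neg hN, integral_zero]
      positivity
  have hind := integral_comp_le_of_dependsOn (p := p) (S := {e : Fin n × Fin m | e.2 ∈ A})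
    (T := {e | e.2 ∈ Aᶜ}) (X := fun B => (cluster B A {v}, cluster B A {w})) (F := F) ?_ ?_ ?_ hF
  · refine le_trans ?_ hind
    have := measureReal_le_integral_div (n := n) (m := m) (p := p)
      (E := {B | d ≤ (cluster B A {v}).card ∧ d ≤ (cluster B A {w}).card ∧
        w ∉ cluster B Finset.univ {v}})
      (F := fun B => F (cluster B A {v}, cluster B A {w}) B) (c := 1) one_pos ?_ ?_
    · simpa using this
    · intro B
      simp only [F]
      split_ifs
      · exact Finset.prod_nonneg fun a _ => hf0 _ a B
      · rfl
    · rintro B ⟨h1, h2, h3⟩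
      have hdis : Disjoint (cluster B A {v}) (cluster B A {w}) := by
        rw [Finset.disjoint_left]
        intro x hx hx'
        refine h3 (cluster_mono (Finset.subset_univ A) ?_)
        rw [mem_cluster_singleton] at *
        exact hx.trans hx'.symm
      simp only [F]
      rw [if_pos ⟨h1, h2, hdis⟩, Finset.prod_eq_one]
      intro a _
      simp only [f]
      by_cases hv : ∀ x ∈ cluster B A {v}, ¬ B (x, a) = true
      · rw [avoids_eq_one hv]; ring
      · by_cases hw : ∀ x ∈ cluster B A {w}, ¬ B (x, a) = true
        · rw [avoids_eq_one hw]; ring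
        · push Not at hv hw
          obtain ⟨x, hx, hxa⟩ := hv
          obtain ⟨y, hy, hya⟩ := hw
          refine absurd ?_ h3
          have hx := cluster_mono (Finset.subset_univ A) hx
          have hy := cluster_mono (Finset.subset_univ A) hy
          rw [mem_cluster_singleton] at *
          refine hx.trans (SimpleGraph.Reachable.trans ?_ hy.symm)
          by_cases hxy : x = y
          · exact hxy ▸ .refl _
          · exact (restrictAux_adj.2 ⟨hxy, a, Finset.mem_univ _, hxa, hya⟩).reachable
  · rw [Set.disjoint_left]
    intro e he he'
    exact (Finset.mem_compl.1 he') he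
  · intro B B' h
    exact Prod.ext (dependsOn_cluster h) (dependsOn_cluster h)
  · intro N B B' h
    simp only [F]
    congr 1
    refine Finset.prod_congr rfl fun a ha => hfd N a fun e he => h e ?_
    obtain rfl : e.2 = a := he
    exact ha

end Sprinkling

/-! ### Concentration of the number of vertices in small components. -/

section SecondMoment

variable {n m : ℕ} {p : unitInterval}

open Classical in
/-- The vertices whose component in the graph spanned by `A` has at most `x` vertices. -/
noncomputable def smallVertices (B : Bipartite n m) (A : Finset (Fin m)) (x : ℝ) : Finset (Fin n) :=
  Finset.univ.filter fun v => ((cluster B A {v}).card : ℝ) ≤ x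

lemma mem_smallVertices {B : Bipartite n m} {A : Finset (Fin m)} {x : ℝ} {v : Fin n} :
    v ∈ smallVertices B A x ↔ ((cluster B A {v}).card : ℝ) ≤ x := by simp [smallVertices]

/-- Chebyshev's inequality for the number of vertices in small components. -/
lemma smallVertices_concentration (A : Finset (Fin m)) {x a b ρ ε : ℝ} (hρ : 0 ≤ ρ) (hε : 0 < ε)
    (hn : 0 < n) (hb : 0 ≤ b)
    (ha : ∀ v, a ≤ (bipartiteLaw n m p).real {B | (cluster B A {v}).card ≤ x})
    (hab : ∀ v w, v ≠ w → (bipartiteLaw n m p).real {B | (cluster B A {v, w}).card ≤ 2 * x} ≤ b) :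
    (bipartiteLaw n m p).real {B | ε * n ≤ |(smallVertices B A x).card - ρ * n|} ≤
      (1 / n + b - 2 * ρ * a + ρ ^ 2) / ε ^ 2 := by
  classical
  have hn' : (0 : ℝ) < n := by exact_mod_cast hn
  let I : Fin n → Bipartite n m → ℝ := fun v => {B | ((cluster B A {v}).card : ℝ) ≤ x}.indicator 1
  have hcard : ∀ B, ((smallVertices B A x).card : ℝ) = ∑ v, I v B := fun B => by
    rw [smallVertices, Finset.card_filter]
    simp only [Nat.cast_sum, I, Set.indicator]
    exact Finset.sum_congr rfl fun v _ => by
      by_cases h : ((cluster B A {v}).card : ℝ) ≤ x <;> simp [h]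
  have hI : ∀ v, ∫ B, I v B ∂bipartiteLaw n m p =
      (bipartiteLaw n m p).real {B | (cluster B A {v}).card ≤ x} := fun v =>
    integral_indicator_one (Set.toFinite _).measurableSet
  have hI01 : ∀ v B, 0 ≤ I v B ∧ I v B ≤ 1 := fun v B => by
    simp only [I, Set.indicator]; split_ifs <;> simp
  have hII : ∀ v w, ∫ B, I v B * I w B ∂bipartiteLaw n m p ≤ (if v = w then 1 else 0) + b := by
    intro v w
    by_cases hvw : v = w
    · rw [if_pos hvw]
      have : ∫ B, I v B * I w B ∂bipartiteLaw n m p ≤ ∫ B, 1 ∂bipartiteLaw n m p :=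
        integral_mono (integrable_bipartiteLaw _) (integrable_bipartiteLaw _) fun B =>
          mul_le_one₀ (hI01 v B).2 (hI01 w B).1 (hI01 w B).2
      simp only [integral_const, probReal_univ, one_smul] at this
      linarith
    -- Two small clusters have a union of at most `2 * x` vertices, whether or not they coincide.
    · rw [if_neg hvw, zero_add]
      refine le_trans ?_ (hab v w hvw)
      rw [← integral_indicator_one (Set.toFinite _).measurableSet]
      refine integral_mono (integrable_bipartiteLaw _) (integrable_bipartiteLaw _) fun B => ?_
      by_cases h1 : ((cluster B A {v}).card : ℝ) ≤ x
      · by_cases h2 : ((cluster B A {w}).card : ℝ) ≤ x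
        · have h3 : ((cluster B A {v, w}).card : ℝ) ≤ 2 * x := by
            have : ((cluster B A {v, w}).card : ℝ) ≤
                (cluster B A {v}).card + (cluster B A {w}).card := by
              have := (Finset.card_le_card (cluster_pair_subset (B := B) (A := A) (v := v)
                (w := w))).trans (Finset.card_union_le _ _)
              exact_mod_cast this
            linarith
          simp [I, Set.indicator, h1, h2, h3]
        · simp [I, Set.indicator, h2]
          split_ifs <;> norm_num
      · simp [I, Set.indicator, h1]
        split_ifs <;> norm_num
  -- Centring at `ρ * n` rather than at the mean requires only a lower bound on the first moment and
  -- an upper bound for pairs.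
  have hsq : ∫ B, ((smallVertices B A x).card - ρ * n) ^ 2 ∂bipartiteLaw n m p ≤
      n + n ^ 2 * b - 2 * ρ * a * n ^ 2 + ρ ^ 2 * n ^ 2 := by
    have e : ∀ B, (((smallVertices B A x).card : ℝ) - ρ * n) ^ 2 =
        (∑ v, ∑ w, I v B * I w B) + ((-(2 * ρ * n)) * ∑ v, I v B + ρ ^ 2 * n ^ 2) := fun B => by
      rw [hcard, ← Finset.sum_mul_sum]; ring
    simp only [e]
    rw [integral_add (integrable_bipartiteLaw _) (integrable_bipartiteLaw _),
      integral_add (integrable_bipartiteLaw _) (integrable_bipartiteLaw _), integral_const_mul,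
      integral_finsetSum _ fun _ _ => integrable_bipartiteLaw _,
      integral_finsetSum _ fun _ _ => integrable_bipartiteLaw _]
    have h1 : ∑ v : Fin n, ∫ B, ∑ w, I v B * I w B ∂bipartiteLaw n m p ≤ n + n ^ 2 * b := by
      calc _ ≤ ∑ v : Fin n, ∑ w : Fin n, ((if v = w then 1 else 0) + b) := by
            refine Finset.sum_le_sum fun v _ => ?_
            rw [integral_finsetSum _ fun _ _ => integrable_bipartiteLaw _]
            exact Finset.sum_le_sum fun w _ => hII v w
        _ = _ := by
            simp [Finset.sum_add_distrib]
            ring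
    have h2 : n * a ≤ ∑ v, ∫ B, I v B ∂bipartiteLaw n m p := by
      calc n * a = ∑ v : Fin n, a := by simp
        _ ≤ _ := Finset.sum_le_sum fun v _ => (ha v).trans_eq (hI v).symm
    have h3 : 2 * ρ * n * (n * a) ≤ 2 * ρ * n * ∑ v, ∫ B, I v B ∂bipartiteLaw n m p := by gcongr
    simp only [integral_const, probReal_univ, one_smul]
    linarith
  have := measureReal_le_integral_div (n := n) (m := m) (p := p)
    (E := {B | ε * n ≤ |(smallVertices B A x).card - ρ * n|})
    (F := fun B => ((smallVertices B A x).card - ρ * n) ^ 2) (c := (ε * n) ^ 2) (by positivity)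
    (fun B => sq_nonneg _) ?_
  · refine this.trans ((div_le_div_of_nonneg_right hsq (by positivity)).trans_eq ?_)
    field_simp
  · intro B hB
    rw [← sq_abs (_ - _)]
    exact pow_le_pow_left₀ (by positivity) hB 2

end SecondMoment

/-! ### Deterministic structure of the large component. -/

section Deterministic

lemma kthLargestSize_one {V : Type*} [Finite V] {G : SimpleGraph V} {c : G.ConnectedComponent}
    (hc : ∀ c' : G.ConnectedComponent, componentSize c' ≤ componentSize c) :
    kthLargestSize G 1 = componentSize c := by
  refine IsGreatest.csSup_eq ⟨?_, fun s hs => ?_⟩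
  · exact (Set.ncard_pos (Set.toFinite _)).2 ⟨c, (le_rfl : componentSize c ≤ componentSize c)⟩
  · obtain ⟨c', hc'⟩ := (Set.ncard_pos (Set.toFinite _)).1 hs
    exact (show s ≤ componentSize c' from hc').trans (hc c')

lemma kthLargestSize_two_le {V : Type*} [Finite V] {G : SimpleGraph V} {c : G.ConnectedComponent}
    {L : ℝ} (hL : 0 ≤ L) (hc : ∀ c' : G.ConnectedComponent, c' ≠ c → (componentSize c' : ℝ) ≤ L) :
    (kthLargestSize G 2 : ℝ) ≤ L := by
  have hmem : ∀ s ∈ {s : ℕ | 2 ≤ {c : G.ConnectedComponent | s ≤ componentSize c}.ncard},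
      s ≤ ⌊L⌋₊ := by
    intro s hs
    obtain ⟨c₁, h1, c₂, h2, hne⟩ := (Set.one_lt_ncard (Set.toFinite _)).1 hs
    refine Nat.le_floor ?_
    by_cases h : c₁ = c
    · have h3 : c₂ ≠ c := fun h' => hne (h.trans h'.symm)
      exact le_trans (by exact_mod_cast (show s ≤ componentSize c₂ from h2)) (hc c₂ h3)
    · exact le_trans (by exact_mod_cast (show s ≤ componentSize c₁ from h1)) (hc c₁ h)
  exact le_trans (by exact_mod_cast csSup_le' hmem) (Nat.floor_le hL)

variable {n m : ℕ} {B : Bipartite n m} {A : Finset (Fin m)}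

/-- If there are no components of intermediate size, before and after the auxiliary vertices outside
`A` are added, if these join all the large components, and if they change the number of vertices in
small components only a little, then there is exactly one large component. -/
lemma exists_unique_large_component {L d ρ ε : ℝ} (hn : 0 < n)
    (hA : ∀ v, ¬ (L ≤ (cluster B A {v}).card ∧ (cluster B A {v}).card ≤ d))
    (hB : ∀ v, ¬ (L ≤ (cluster B Finset.univ {v}).card ∧ (cluster B Finset.univ {v}).card ≤ d))
    (hNA : |((smallVertices B A L).card : ℝ) - ρ * n| < ε * n)
    (hNB : |((smallVertices B Finset.univ L).card : ℝ) - ρ * n| < ε * n)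
    (hjoin : ∀ v w, d ≤ (cluster B A {v}).card → d ≤ (cluster B A {w}).card →
      w ∈ cluster B Finset.univ {v})
    (hd : 2 * ε * n ≤ d) (hε : ρ + ε ≤ 1) :
    ∃ c : (intersectionGraph B).ConnectedComponent, L < componentSize c ∧
      (∀ c' : (intersectionGraph B).ConnectedComponent, L < componentSize c' → c' = c) ∧
      |(componentSize c : ℝ) / n - (1 - ρ)| < ε := by
  classical
  have hn' : (0 : ℝ) < n := by exact_mod_cast hn
  rw [abs_lt] at hNA hNB
  have hbigA : ∀ v, v ∉ smallVertices B A L → d ≤ (cluster B A {v}).card := fun v hv => by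
    rw [mem_smallVertices, not_le] at hv
    by_contra! h
    exact hA v ⟨hv.le, h.le⟩
  have hbigB : ∀ v, v ∉ smallVertices B Finset.univ L → d < (cluster B Finset.univ {v}).card :=
    fun v hv => by
      rw [mem_smallVertices, not_le] at hv
      by_contra! h
      exact hB v ⟨hv.le, h⟩
  have hsub : smallVertices B Finset.univ L ⊆ smallVertices B A L := fun v hv => by
    rw [mem_smallVertices] at *
    refine le_trans ?_ hv
    exact_mod_cast Finset.card_le_card (cluster_mono (B := B) (U := {v}) (Finset.subset_univ A))
  have hclass : ∀ {v w}, w ∈ cluster B Finset.univ {v} →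
      (w ∈ smallVertices B Finset.univ L ↔ v ∈ smallVertices B Finset.univ L) := fun h => by
    rw [mem_smallVertices, mem_smallVertices, cluster_eq_of_mem h]
  obtain ⟨v, hv⟩ : ∃ v, v ∉ smallVertices B A L := by
    by_contra! h
    rw [Finset.eq_univ_iff_forall.2 h, Finset.card_univ, Fintype.card_fin] at hNA
    nlinarith
  have hv' : v ∉ smallVertices B Finset.univ L := fun h => hv (hsub h)
  -- A second large component cannot contain an `A`-large vertex, which would be joined to `v`. So
  -- all its more than `d` vertices were `A`-small and have ceased to be small, yet the small count
  -- drops by less than `2 * ε * n ≤ d`.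
  have hall : ∀ w, w ∉ smallVertices B Finset.univ L → w ∈ cluster B Finset.univ {v} := by
    intro w hw
    by_contra hwv
    have hdis : Disjoint (smallVertices B Finset.univ L) (cluster B Finset.univ {w}) := by
      rw [Finset.disjoint_right]
      exact fun x hx hx' => hw ((hclass hx).1 hx')
    have hun : smallVertices B Finset.univ L ∪ cluster B Finset.univ {w} ⊆ smallVertices B A L := by
      refine Finset.union_subset hsub fun x hx => ?_
      by_contra hxs
      refine hwv ?_
      have h1 := hjoin v x (hbigA v hv) (hbigA x hxs)
      rw [mem_cluster_singleton] at *
      exact h1.trans hx.symm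
    have hcard := Finset.card_le_card hun
    rw [Finset.card_union_of_disjoint hdis] at hcard
    have hcard' : ((smallVertices B Finset.univ L).card : ℝ) + (cluster B Finset.univ {w}).card ≤
        (smallVertices B A L).card := by exact_mod_cast hcard
    have := hbigB w hw
    linarith
  have hcompl : cluster B Finset.univ {v} = (smallVertices B Finset.univ L)ᶜ := by
    ext w
    rw [Finset.mem_compl]
    exact ⟨fun h h' => hv' ((hclass h).1 h'), hall w⟩
  refine ⟨(intersectionGraph B).connectedComponentMk v, ?_, ?_, ?_⟩
  · rw [componentSize_eq]
    rwa [mem_smallVertices, not_le] at hv'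
  · intro c' hc'
    induction c' using SimpleGraph.ConnectedComponent.ind with | _ w =>
    rw [componentSize_eq, ← not_le, ← mem_smallVertices] at hc'
    have := hall w hc'
    rw [mem_cluster_singleton, restrictAux_univ] at this
    exact SimpleGraph.ConnectedComponent.eq.2 this.symm
  · rw [componentSize_eq, hcompl, Finset.card_compl, Nat.cast_sub (Finset.card_le_univ _),
      Fintype.card_fin, sub_div, div_self hn'.ne', abs_lt]
    constructor
    · have : ((smallVertices B Finset.univ L).card : ℝ) / n < ρ + ε := by
        rw [div_lt_iff₀ hn']; linarith
      linarith
    · have : ρ - ε < ((smallVertices B Finset.univ L).card : ℝ) / n := by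
        rw [lt_div_iff₀ hn']; linarith
      linarith

end Deterministic

/-! ### Limits and choice of constants. -/

section Asymptotics

variable {β γ : ℝ}

lemma measureReal_exists_le {n m : ℕ} {p : unitInterval} {ι : Type*} [Fintype ι]
    {E : ι → Bipartite n m → Prop} {c : ℝ}
    (h : ∀ i, (bipartiteLaw n m p).real {B | E i B} ≤ c) :
    (bipartiteLaw n m p).real {B | ∃ i, E i B} ≤ Fintype.card ι * c := by
  have : {B | ∃ i, E i B} = ⋃ i, {B | E i B} := by ext; simp
  rw [this]
  refine (measureReal_iUnion_fintype_le _).trans ?_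
  calc _ ≤ ∑ _i : ι, c := Finset.sum_le_sum fun i _ => h i
    _ = _ := by simp

lemma edgeProb_coe {n : ℕ} (hγ : 0 < γ) (hn : 0 < n) (h : γ ≤ n) : (edgeProb γ n : ℝ) = γ / n := by
  have hn' : (0 : ℝ) < n := by exact_mod_cast hn
  rw [edgeProb, Set.projIcc_of_mem _ ⟨by positivity, (div_le_one hn').2 h⟩]

lemma natCast_mul_edgeProb {n : ℕ} (hγ : 0 < γ) (hn : 0 < n) (h : γ ≤ n) :
    n * (edgeProb γ n : ℝ) = γ := by
  have hn' : (n : ℝ) ≠ 0 := by exact_mod_cast hn.ne'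
  rw [edgeProb_coe hγ hn h]; field_simp

lemma auxCount_mul_edgeProb_le {n : ℕ} (hβ : 0 < β) (hγ : 0 < γ) (hn : 0 < n) (h : γ ≤ n) :
    auxCount β n * (edgeProb γ n : ℝ) ≤ β * γ := by
  calc auxCount β n * (edgeProb γ n : ℝ) ≤ β * n * (edgeProb γ n : ℝ) :=
        mul_le_mul_of_nonneg_right (Nat.floor_le (by positivity)) (edgeProb γ n).2.1
    _ = β * γ := by rw [mul_assoc, natCast_mul_edgeProb hγ hn h]

lemma tendsto_prob_zero {Q : (n : ℕ) → SimpleGraph (Fin n) → Prop}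
    (h : ∀ κ > 0, ∀ᶠ n : ℕ in atTop, (bipartiteLaw n (auxCount β n) (edgeProb γ n)).real
      {B | Q n (intersectionGraph B)} ≤ κ) :
    Tendsto (fun n : ℕ => prob β γ n (Q n)) atTop (𝓝 0) := by
  have hfin : ∀ n : ℕ, prob β γ n (Q n) ≠ ⊤ := fun n => by unfold prob; exact measure_ne_top _ _
  rw [← ENNReal.tendsto_toReal_iff hfin ENNReal.zero_ne_top, ENNReal.toReal_zero, tendsto_order]
  refine ⟨fun a ha => Eventually.of_forall fun n => ha.trans_le ENNReal.toReal_nonneg,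
    fun a ha => ?_⟩
  filter_upwards [h (a / 2) (by linarith)] with n hn
  exact lt_of_le_of_lt hn (by linarith)

lemma aas_of_measureReal_le {Q : (n : ℕ) → SimpleGraph (Fin n) → Prop}
    (h : ∀ κ > 0, ∀ᶠ n : ℕ in atTop, (bipartiteLaw n (auxCount β n) (edgeProb γ n)).real
      {B | ¬ Q n (intersectionGraph B)} ≤ κ) : AAS β γ Q := by
  have h0 := tendsto_prob_zero (Q := fun n G => ¬ Q n G) h
  have h1 := ENNReal.Tendsto.sub (tendsto_const_nhds (x := (1 : ENNReal)) (f := atTop)) h0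
    (.inl ENNReal.one_ne_top)
  rw [tsub_zero] at h1
  refine h1.congr fun n => ?_
  have := prob_compl_eq_one_sub (μ := bipartiteLaw n (auxCount β n) (edgeProb γ n))
    (s := {B | ¬ Q n (intersectionGraph B)}) (Set.toFinite _).measurableSet
  simp only [prob]
  rw [← this]
  congr 1
  ext B
  simp

/-- Explains the constant `C = 2 / log s`: the tail at `C * log n` is `n⁻²`, which beats a union
bound over `n` vertices. -/
lemma rpow_neg_mul_log {s : ℝ} (hs : 1 < s) {n : ℕ} (hn : 0 < n) :
    s ^ (-(2 / Real.log s * Real.log n)) = 1 / (n : ℝ) ^ 2 := by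
  have hn' : (0 : ℝ) < n := by exact_mod_cast hn
  have hl : Real.log s ≠ 0 := (Real.log_pos hs).ne'
  rw [Real.rpow_def_of_pos (by linarith), show Real.log s * -(2 / Real.log s * Real.log n) =
    -(((2 : ℕ) : ℝ) * Real.log n) by field_simp; push_cast; ring, Real.exp_neg, Real.exp_nat_mul,
    Real.exp_log hn', one_div]

lemma tendsto_pow_mul_exp_neg (k : ℕ) {c : ℝ} (hc : 0 < c) :
    Tendsto (fun n : ℕ => (n : ℝ) ^ k * Real.exp (-(c * n))) atTop (𝓝 0) := by
  have h := Real.tendsto_pow_mul_exp_neg_atTop_nhds_zero k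
  have h1 : Tendsto (fun n : ℕ => c * (n : ℝ)) atTop atTop :=
    tendsto_natCast_atTop_atTop.const_mul_atTop hc
  have h2 := (h.comp h1).const_mul ((c ^ k)⁻¹)
  rw [mul_zero] at h2
  refine h2.congr fun n => ?_
  simp only [Function.comp, mul_pow]
  field_simp

theorem aas_componentSize_le (hβ : 0 < β) (hγ : 0 < γ) (h : β * γ ^ 2 < 1) :
    ∃ C : ℝ, 0 < C ∧
      AAS β γ fun n G => ∀ c : G.ConnectedComponent, (componentSize c : ℝ) ≤ C * Real.log n := by
  obtain ⟨ζ, hζ, s, hs, htail⟩ := subcritical_tail hγ h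
  refine ⟨2 / Real.log s, div_pos two_pos (Real.log_pos hs), aas_of_measureReal_le fun κ hκ => ?_⟩
  have h1 : Tendsto (fun n : ℕ => ζ * (1 / (n : ℝ))) atTop (𝓝 0) := by
    simpa using tendsto_one_div_atTop_nhds_zero_nat.const_mul ζ
  filter_upwards [h1.eventually_lt_const hκ, eventually_gt_atTop 0,
    tendsto_natCast_atTop_atTop.eventually_ge_atTop γ] with n hn hn0 hnγ
  have hn' : (0 : ℝ) < n := by exact_mod_cast hn0
  have h2 := measureReal_exists_le (p := edgeProb γ n)
    fun v => htail n (auxCount β n) (edgeProb γ n) (auxCount_mul_edgeProb_le hβ hγ hn0 hnγ)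
      (natCast_mul_edgeProb hγ hn0 hnγ).le v (2 / Real.log s * Real.log n)
  refine le_trans (measureReal_mono fun B hB => ?_) (h2.trans (le_trans (le_of_eq ?_) hn.le))
  · simp only [Set.mem_ofPred_eq, not_forall, not_le] at hB ⊢
    obtain ⟨c, hc⟩ := hB
    induction c using SimpleGraph.ConnectedComponent.ind with | _ w =>
    rw [componentSize_eq] at hc
    exact ⟨w, hc.le⟩
  · rw [rpow_neg_mul_log hs hn0, Fintype.card_fin]
    field_simp

/-- The union bound over the failures of the hypotheses of `exists_unique_large_component`. -/
lemma measureReal_not_exists_unique_large_le {n m : ℕ} {p : unitInterval} {A : Finset (Fin m)}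
    {L d ρ ε ε₀ q : ℝ} (hn : 0 < n) (hd : 2 * ε * n ≤ d) (hε : ρ + ε ≤ 1) (hεε₀ : ε ≤ ε₀)
    (hA : (bipartiteLaw n m p).real
      {B | ∃ v, L ≤ (cluster B A {v}).card ∧ (cluster B A {v}).card ≤ d} ≤ q)
    (hB : (bipartiteLaw n m p).real {B | ∃ v, L ≤ (cluster B Finset.univ {v}).card ∧
      (cluster B Finset.univ {v}).card ≤ d} ≤ q)
    (hNA : (bipartiteLaw n m p).real
      {B | ε * n ≤ |(smallVertices B A L).card - ρ * n|} ≤ q)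
    (hNB : (bipartiteLaw n m p).real
      {B | ε * n ≤ |(smallVertices B Finset.univ L).card - ρ * n|} ≤ q)
    (hjoin : (bipartiteLaw n m p).real {B | ∃ vw : Fin n × Fin n,
      d ≤ (cluster B A {vw.1}).card ∧ d ≤ (cluster B A {vw.2}).card ∧
      vw.2 ∉ cluster B Finset.univ {vw.1}} ≤ q) :
    (bipartiteLaw n m p).real
      {B | ¬ ∃ c : (intersectionGraph B).ConnectedComponent, L < componentSize c ∧
        (∀ c' : (intersectionGraph B).ConnectedComponent, L < componentSize c' → c' = c) ∧
        |(componentSize c : ℝ) / n - (1 - ρ)| < ε₀} ≤ 5 * q := by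
  set E₁ := {B : Bipartite n m | ∃ v, L ≤ (cluster B A {v}).card ∧ (cluster B A {v}).card ≤ d}
    with hE₁
  set E₂ := {B : Bipartite n m | ∃ v, L ≤ (cluster B Finset.univ {v}).card ∧
    (cluster B Finset.univ {v}).card ≤ d} with hE₂
  set E₃ := {B : Bipartite n m | ε * n ≤ |(smallVertices B A L).card - ρ * n|} with hE₃
  set E₄ := {B : Bipartite n m | ε * n ≤ |(smallVertices B Finset.univ L).card - ρ * n|} with hE₄
  set E₅ := {B : Bipartite n m | ∃ vw : Fin n × Fin n,
    d ≤ (cluster B A {vw.1}).card ∧ d ≤ (cluster B A {vw.2}).card ∧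
    vw.2 ∉ cluster B Finset.univ {vw.1}} with hE₅
  have hsub : {B : Bipartite n m | ¬ ∃ c : (intersectionGraph B).ConnectedComponent,
      L < componentSize c ∧
        (∀ c' : (intersectionGraph B).ConnectedComponent, L < componentSize c' → c' = c) ∧
        |(componentSize c : ℝ) / n - (1 - ρ)| < ε₀} ⊆ E₁ ∪ E₂ ∪ E₃ ∪ E₄ ∪ E₅ := by
    intro B hB
    by_contra hcon
    simp only [hE₁, hE₂, hE₃, hE₄, hE₅, Set.mem_union, Set.mem_ofPred_eq, not_or, not_exists,
      not_le] at hcon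
    obtain ⟨⟨⟨⟨g1, g2⟩, g3⟩, g4⟩, g5⟩ := hcon
    refine hB ?_
    obtain ⟨c, hc1, hc2, hc3⟩ := exists_unique_large_component hn g1 g2 g3 g4
      (fun v w hv hw => by
        by_contra hvw
        exact g5 (v, w) ⟨hv, hw, hvw⟩) hd hε
    exact ⟨c, hc1, hc2, hc3.trans_le hεε₀⟩
  have h0 := measureReal_mono (μ := bipartiteLaw n m p) hsub
  have h1 := measureReal_union_le (μ := bipartiteLaw n m p) (E₁ ∪ E₂ ∪ E₃ ∪ E₄) E₅
  have h2 := measureReal_union_le (μ := bipartiteLaw n m p) (E₁ ∪ E₂ ∪ E₃) E₄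
  have h3 := measureReal_union_le (μ := bipartiteLaw n m p) (E₁ ∪ E₂) E₃
  have h4 := measureReal_union_le (μ := bipartiteLaw n m p) E₁ E₂
  linarith

set_option maxHeartbeats 600000 in
/-- The structure of the supercritical graph: with high probability there is exactly one component
of more than logarithmic size, and it contains a proportion of about `1 - ρ` of the vertices. -/
theorem exists_giant (hβ : 0 < β) (hγ : 0 < γ) {ρ : ℝ} (hρ0 : 0 < ρ) (hρ1 : ρ < 1)
    (hlow : ∀ s, 0 ≤ s → s < ρ → s < cpoissonGF (β * γ) γ s)
    (hupp : ∀ s, ρ < s → s < 1 → cpoissonGF (β * γ) γ s < s) :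
    ∃ C : ℝ, 0 < C ∧ ∀ ε > 0, ∀ κ > 0, ∀ᶠ n : ℕ in atTop,
      (bipartiteLaw n (auxCount β n) (edgeProb γ n)).real
        {B | ¬ ∃ c : (intersectionGraph B).ConnectedComponent, C * Real.log n < componentSize c ∧
          (∀ c' : (intersectionGraph B).ConnectedComponent,
            C * Real.log n < componentSize c' → c' = c) ∧
          |(componentSize c : ℝ) / n - (1 - ρ)| < ε} ≤ κ := by
  -- Any fixed ζ in (ρ, 1) serves here. It determines `C` before the accuracy and the error
  -- probability are given.
  obtain ⟨δ₀, hδ₀, s₀, hs₀, c₀, hc₀, b₀, hb₀, hgap₀⟩ := cluster_gap (ζ := (ρ + 1) / 2) hβ hγ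
    (by linarith) (by linarith) (hupp _ (by linarith) (by linarith))
  have hC : 0 < 2 / Real.log s₀ := div_pos two_pos (Real.log_pos hs₀)
  refine ⟨2 / Real.log s₀, hC, fun ε₀ hε₀ κ hκ => ?_⟩
  set C := 2 / Real.log s₀ with hCdef
  obtain ⟨ε, hε, hεε₀, hεδ, hερ⟩ : ∃ ε > 0, ε ≤ ε₀ ∧ 2 * ε ≤ δ₀ ∧ ρ + ε ≤ 1 := by
    refine ⟨min ε₀ (min (δ₀ / 2) (1 - ρ)), by simp [hε₀, hδ₀, hρ1], min_le_left _ _, ?_, ?_⟩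
    · have := (min_le_right ε₀ (min (δ₀ / 2) (1 - ρ))).trans (min_le_left _ _); linarith
    · have := (min_le_right ε₀ (min (δ₀ / 2) (1 - ρ))).trans (min_le_right _ _); linarith
  -- The limiting Chebyshev bound when ρ is approximated by `ρ ± y`; it vanishes at `y = 0`.
  obtain ⟨y, hy0, hyρ, hy1, hy⟩ : ∃ y, 0 < y ∧ y < ρ ∧ y < 1 - ρ ∧
      ((ρ + y) ^ 2 - 2 * ρ * (ρ - y) + ρ ^ 2) / ε ^ 2 < κ / 5 := by
    have hc : Continuous fun y : ℝ => ((ρ + y) ^ 2 - 2 * ρ * (ρ - y) + ρ ^ 2) / ε ^ 2 := by fun_prop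
    have h1 := (hc.tendsto 0).eventually_lt_const (u := κ / 5) (by
      ring_nf; positivity)
    obtain ⟨y, ⟨⟨h1, h2⟩, h3⟩, h4⟩ := ((((h1.and (gt_mem_nhds hρ0)).and
      (gt_mem_nhds (sub_pos.2 hρ1))).filter_mono (nhdsWithin_le_nhds (s := Set.Ioi 0))).and
      self_mem_nhdsWithin).exists
    exact ⟨y, h4, h2, h3, h1⟩
  obtain ⟨δ₁, hδ₁, s₁, hs₁, c₁, hc₁, b₁, hb₁, hgap₁⟩ := cluster_gap (ζ := ρ + y) hβ hγ
    (by linarith) (by linarith) (hupp _ (by linarith) (by linarith))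
  obtain ⟨s₂, hs₂, hs₂1, p₀, hp₀, hsmall⟩ := le_measureReal_small_cluster (β := β) (ζ := ρ - y) hγ
    (by linarith) (by linarith) (hlow _ (by linarith) (by linarith))
  -- About `b * n` auxiliary vertices suffice for both gap estimates; the other `(β - b) * n` are
  -- kept for sprinkling.
  obtain ⟨b, hb, hb0, hbb₀, hbb₁⟩ : ∃ b, b < β ∧ 0 ≤ b ∧ b₀ ≤ b ∧ b₁ ≤ b :=
    ⟨max 0 (max b₀ b₁), by simp [hβ, hb₀, hb₁], le_max_left _ _,
      (le_max_left _ _).trans (le_max_right _ _), (le_max_right _ _).trans (le_max_right _ _)⟩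
  set t := (1 - Real.exp (-(γ * δ₀))) ^ 2 with ht
  have het : Real.exp (-(γ * δ₀)) < 1 := Real.exp_lt_one_iff.2 (by have := mul_pos hγ hδ₀; linarith)
  have ht0 : 0 < t := pow_pos (by linarith) 2
  have hlog : Tendsto (fun n : ℕ => C * Real.log n) atTop atTop :=
    (Real.tendsto_log_atTop.comp tendsto_natCast_atTop_atTop).const_mul_atTop hC
  have lim1 : Tendsto (fun n : ℕ => (ρ + 1) / 2 * (1 / (n : ℝ)) +
      2 * ((n : ℝ) ^ 1 * Real.exp (-(c₀ * n)))) atTop (𝓝 0) := by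
    simpa using (tendsto_one_div_atTop_nhds_zero_nat.const_mul ((ρ + 1) / 2)).add
      ((tendsto_pow_mul_exp_neg 1 hc₀).const_mul 2)
  have lim2 : Tendsto (fun n : ℕ => (1 / (n : ℝ) + ((ρ + y) ^ 2 +
      4 * ((n : ℝ) ^ 0 * Real.exp (-(c₁ * n)))) -
      2 * ρ * (ρ - y - s₂ ^ (C * Real.log n)) + ρ ^ 2) / ε ^ 2) atTop
      (𝓝 (((ρ + y) ^ 2 - 2 * ρ * (ρ - y) + ρ ^ 2) / ε ^ 2)) := by
    have h1 : Tendsto (fun n : ℕ => s₂ ^ (C * Real.log n)) atTop (𝓝 0) :=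
      (tendsto_rpow_atTop_of_base_lt_one s₂ (by linarith) hs₂1).comp hlog
    have := ((((tendsto_one_div_atTop_nhds_zero_nat (𝕜 := ℝ)).add
      (((tendsto_pow_mul_exp_neg 0 hc₁).const_mul 4).const_add ((ρ + y) ^ 2))).sub
      ((h1.const_sub (ρ - y)).const_mul (2 * ρ))).add_const (ρ ^ 2)).div_const (ε ^ 2)
    simpa using this
  have lim3 : Tendsto (fun n : ℕ => Real.exp (2 * t) * ((n : ℝ) ^ 2 *
      Real.exp (-(t * (β - b) * n)))) atTop (𝓝 0) := by
    simpa using (tendsto_pow_mul_exp_neg 2 (mul_pos ht0 (sub_pos.2 hb))).const_mul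
      (Real.exp (2 * t))
  have lim4 : Tendsto (fun n : ℕ => 2 * (C * (Real.log n / n))) atTop (𝓝 0) := by
    have := (Real.isLittleO_log_id_atTop.tendsto_div_nhds_zero).comp
      (tendsto_natCast_atTop_atTop (R := ℝ))
    simpa using (this.const_mul C).const_mul 2
  have lim5 : Tendsto (fun n : ℕ => γ / (n : ℝ)) atTop (𝓝 0) := tendsto_const_div_atTop_nhds_zero_nat γ
  filter_upwards [lim1.eventually_lt_const (show 0 < κ / 5 by positivity),
    lim2.eventually_lt_const hy, lim3.eventually_lt_const (show 0 < κ / 5 by positivity),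
    lim4.eventually_lt_const hδ₁, lim5.eventually_lt_const hp₀,
    eventually_gt_atTop 0, tendsto_natCast_atTop_atTop.eventually_ge_atTop γ,
    (tendsto_natCast_atTop_atTop.const_mul_atTop (sub_pos.2 hb)).eventually_ge_atTop (2 : ℝ)]
    with n e1 e2 e3 e4 e5 hn0 hnγ e6
  have hn' : (0 : ℝ) < n := by exact_mod_cast hn0
  set m := auxCount β n with hm
  set p := edgeProb γ n with hp
  set L := C * Real.log n with hL
  have hmp : m * (p : ℝ) ≤ β * γ := auxCount_mul_edgeProb_le hβ hγ hn0 hnγ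
  have hnp : n * (p : ℝ) = γ := natCast_mul_edgeProb hγ hn0 hnγ
  have hmβ : β * n - 1 < m := Nat.sub_one_lt_floor _
  have hceil : ⌈b * n⌉₊ ≤ m := by
    have h1 : (⌈b * n⌉₊ : ℝ) < b * n + 1 := Nat.ceil_lt_add_one (by positivity)
    have h2 : (⌈b * n⌉₊ : ℝ) ≤ m := by linarith
    exact_mod_cast h2
  obtain ⟨A, -, hAcard⟩ := Finset.exists_subset_card_eq (s := (Finset.univ : Finset (Fin m)))
    (n := ⌈b * n⌉₊) (by simpa using hceil)
  have hA : b * n ≤ A.card := hAcard ▸ Nat.le_ceil _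
  have hU : b * n ≤ (Finset.univ : Finset (Fin m)).card :=
    hA.trans (by exact_mod_cast Finset.card_le_univ A)
  -- The 2 covers the floor in `m` and the ceiling in the size of `A`; it reappears as the factor
  -- `exp (2 * t)`.
  have hAc : (β - b) * n - 2 ≤ (Aᶜ).card := by
    have h1 : (⌈b * n⌉₊ : ℝ) < b * n + 1 := Nat.ceil_lt_add_one (by positivity)
    rw [Finset.card_compl, Nat.cast_sub (Finset.card_le_univ _), hAcard, Fintype.card_fin]
    linarith
  have hmid : ∀ A : Finset (Fin m), b * n ≤ A.card → (bipartiteLaw n m p).real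
      {B | ∃ v, L ≤ (cluster B A {v}).card ∧ (cluster B A {v}).card ≤ δ₀ * n} ≤ κ / 5 := by
    intro A hA
    have h1 := measureReal_exists_le (n := n) (m := m) (p := p)
      (E := fun v B => L ≤ (cluster B A {v}).card ∧ (cluster B A {v}).card ≤ δ₀ * n)
      (c := (ρ + 1) / 2 * s₀ ^ (-L) + 2 * Real.exp (-(c₀ * n)))
      fun v => (hgap₀ n m p hmp hnp A {v} L (le_trans (by gcongr) hA)).trans_eq (by
        rw [Finset.card_singleton, pow_one, pow_one])
    refine h1.trans (le_trans (le_of_eq ?_) e1.le)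
    rw [rpow_neg_mul_log hs₀ hn0, Fintype.card_fin]
    field_simp
  have hconc : ∀ A : Finset (Fin m), b * n ≤ A.card → (bipartiteLaw n m p).real
      {B | ε * n ≤ |(smallVertices B A L).card - ρ * n|} ≤ κ / 5 := by
    intro A hA
    refine (smallVertices_concentration A hρ0.le hε hn0 (by positivity)
      (fun v => hsmall n m p ?_ hmp hnp.le A v L) fun v w hvw => ?_).trans e2.le
    · rw [hp, edgeProb_coe hγ hn0 hnγ]; exact e5.le
    -- With lower size bound 0 and two starting vertices the gap estimate becomes the pair bound `(ρ
    -- + y) ^ 2` plus an exponentially small term.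
    · have h1 := hgap₁ n m p hmp hnp A {v, w} 0 (le_trans (by gcongr) hA)
      rw [Finset.card_pair hvw, neg_zero, Real.rpow_zero, mul_one] at h1
      refine (measureReal_mono fun B hB => ?_).trans (h1.trans_eq (by ring))
      refine ⟨Nat.cast_nonneg _, le_trans hB ?_⟩
      have : 2 * (C * (Real.log n / n)) * n ≤ δ₁ * n := by gcongr
      refine le_trans (le_of_eq ?_) this
      rw [hL]; field_simp
  have hspr : (bipartiteLaw n m p).real {B | ∃ vw : Fin n × Fin n,
      δ₀ * n ≤ (cluster B A {vw.1}).card ∧ δ₀ * n ≤ (cluster B A {vw.2}).card ∧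
      vw.2 ∉ cluster B Finset.univ {vw.1}} ≤ κ / 5 := by
    have h1 := measureReal_exists_le (p := p) fun vw : Fin n × Fin n =>
      sprinkling A vw.1 vw.2 (d := δ₀ * n) (by positivity)
    refine h1.trans (le_trans ?_ e3.le)
    rw [Fintype.card_prod, Fintype.card_fin, show (p : ℝ) * (δ₀ * n) = γ * δ₀ by
      rw [← hnp]; ring, ← ht]
    have ht1 : t ≤ 1 := pow_le_one₀ (by linarith) (by linarith [Real.exp_pos (-(γ * δ₀))])
    have h2 : (1 - t) ^ (Aᶜ).card ≤ Real.exp (2 * t) * Real.exp (-(t * (β - b) * n)) := by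
      calc (1 - t) ^ (Aᶜ).card ≤ Real.exp (-t) ^ (Aᶜ).card := by
            exact pow_le_pow_left₀ (by linarith) (Real.one_sub_le_exp_neg t) _
        _ = Real.exp ((Aᶜ).card * -t) := (Real.exp_nat_mul _ _).symm
        _ ≤ Real.exp (2 * t + -(t * (β - b) * n)) := Real.exp_le_exp.2 (by nlinarith)
        _ = _ := Real.exp_add _ _
    push_cast
    calc (n : ℝ) * n * (1 - t) ^ (Aᶜ).card
        ≤ n * n * (Real.exp (2 * t) * Real.exp (-(t * (β - b) * n))) := by gcongr
      _ = _ := by ring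
  refine (measureReal_not_exists_unique_large_le hn0
    (mul_le_mul_of_nonneg_right hεδ hn'.le) hερ hεε₀ (hmid A hA) (hmid _ hU)
    (hconc A hA) (hconc _ hU) hspr).trans_eq (by ring)

end Asymptotics

end RandomIntersectionGraph

open RandomIntersectionGraph in
theorem theorem1 (β γ : ℝ) (hβ : 0 < β) (hγ : 0 < γ) :
    (β * γ ^ 2 < 1 →
      ∃ C : ℝ, 0 < C ∧
        AAS β γ fun n G => ∀ c : G.ConnectedComponent, (componentSize c : ℝ) ≤ C * Real.log n) ∧
    (1 < β * γ ^ 2 →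
      ∃ ρ : ℝ, IsLeast {s : ℝ | 0 ≤ s ∧ s = cpoissonGF (β * γ) γ s} ρ ∧ 0 < ρ ∧ ρ < 1 ∧
        (TendstoInProb β γ (fun n G => (kthLargestSize G 1 : ℝ) / n) (1 - ρ)) ∧
        ∃ C : ℝ, 0 < C ∧
          (AAS β γ fun n G =>
            ∃! c : G.ConnectedComponent, C * Real.log n < (componentSize c : ℝ)) ∧
          AAS β γ fun n G => (kthLargestSize G 2 : ℝ) ≤ C * Real.log n) := by
  refine ⟨aas_componentSize_le hβ hγ, fun h => ?_⟩
  obtain ⟨ρ, hleast, hρ0, hρ1, hlow, hupp⟩ := exists_isLeast_fixedPoint (a := β * γ) (b := γ)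
    (mul_pos hβ hγ) (by linarith)
  obtain ⟨C, hC, hgiant⟩ := exists_giant hβ hγ hρ0 hρ1 hlow hupp
  refine ⟨ρ, hleast, hρ0, hρ1, fun ε hε => ?_, C, hC, ?_, ?_⟩
  · refine tendsto_prob_zero (Q := fun n G => ε ≤ |(kthLargestSize G 1 : ℝ) / n - (1 - ρ)|)
      fun κ hκ => ?_
    filter_upwards [hgiant ε hε κ hκ] with n hn
    refine (measureReal_mono fun B hB => ?_).trans hn
    rintro ⟨c, hc1, hc2, hc3⟩
    refine absurd hc3 (not_lt.2 ?_)
    rw [← kthLargestSize_one (c := c) fun c' => ?_]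
    · exact hB
    · by_contra! hlt
      have : C * Real.log n < componentSize c' := hc1.trans (by exact_mod_cast hlt)
      rw [hc2 c' this] at hlt
      exact lt_irrefl _ hlt
  · refine aas_of_measureReal_le fun κ hκ => ?_
    -- The accuracy 1 is arbitrary: only existence and uniqueness are used.
    filter_upwards [hgiant 1 one_pos κ hκ] with n hn
    refine (measureReal_mono fun B hB => ?_).trans hn
    rintro ⟨c, hc1, hc2, -⟩
    exact hB ⟨c, hc1, hc2⟩
  · refine aas_of_measureReal_le fun κ hκ => ?_
    filter_upwards [hgiant 1 one_pos κ hκ, eventually_gt_atTop 0] with n hn hn0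
    refine (measureReal_mono fun B hB => ?_).trans hn
    rintro ⟨c, hc1, hc2, -⟩
    refine hB (kthLargestSize_two_le (c := c)
      (mul_nonneg hC.le (Real.log_nonneg (by exact_mod_cast hn0))) fun c' hc' => ?_)
    by_contra! hlt
    exact hc' (hc2 c' hlt)
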